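/- **Setting.** A *lamination* $M$ is a disjoint union of leaves, each leaf a complete metric space with metric $d$; $\mathcal F_m$ is the leaf of $m$ and $\mathcal F_m(r)=\{m'\in\mathcal F_m: d(m,m')<r\}$ the plaque of radius $r$. Let $\phi:M\to M$ map leaves into leaves, and let $\lambda_s:M\to[0,\infty)$ be bounded. For $\varepsilon>0$ let $\mathrm{(HS1)}_\varepsilon$ be the condition: for every $m$, $\phi$ maps $\mathcal F_m(\varepsilon)$ into $\mathcal F_{\phi(m)}(\varepsilon)$ and is $\lambda_s(m)$-Lipschitz on $\mathcal F_m(\varepsilon)$. Let $\mathcal E$ be a bundle over $M$ whose fibers $\mathcal E_m$ are non-empty complete metric spaces, let $\varepsilon'>0$, and let every $m$ carry one bundle chart $\varphi^m$, with bijections $\varphi^m_{m'}:\mathcal E_m\to\mathcal E_{m'}$ for $m'\in\mathcal F_m(\varepsilon')$ and $\varphi^m_m=\mathrm{id}$. Assume that $\mathcal E$ is a uniform $C^{0,1}$-fiber bundle: $\operatorname{Lip}(\varphi^m_{m'})^{\pm1}\le 1+\eta(d(m,m'))$ with one continuous $\eta$, $\eta(0)=0$, and the transition maps $(m,x)\mapsto(\varphi^{m_1}_m)^{-1}\varphi^{m_0}_m(x)$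 are continuous. Let $H(m,x)=(\phi(m),H_m(x))$ be a bundle map with continuous fiber maps $H_m:\mathcal E_m\to\mathcal E_{\phi(m)}$ such that 1. $H_m$ has a left inverse $H_m^{-1}:\mathcal E_{\phi(m)}\to\mathcal E_m$, and $H_m(\mathcal E_m)$ is open and meets every connected component of $\mathcal E_{\phi(m)}$ (the last is automatic if the fibers are connected or $H_m$ is onto); 2. $\sup_m\operatorname{Lip}H_m^{-1}<\infty$, and $m\mapsto H_m^{-1}$ is uniformly Lipschitz in the local representations with respect to the charts: there is $L$ such that for all $m_0$, $n_0$ and $y\in\mathcal E_{n_0}$ the map $m\mapsto(\varphi^{m_0}_m)^{-1}H_m^{-1}\varphi^{n_0}_{\phi(m)}(y)$ is $L$-Lipschitz on $\mathcal F_{m_0}(\varepsilon')\cap\phi^{-1}(\mathcal F_{n_0}(\varepsilon'))$; 3. $\sup_m\operatorname{Lip}H_m^{-1}\cdot\lambda_s(m)<1$. **Theorem.** There is $\varepsilon_0\in(0,\varepsilon']$ such that for every $\varepsilon\in(0,\varepsilon_0)$ for which $\mathrm{(HS1)}_\varepsilon$ holds there is exactly one family $\mathcal W_\varepsilon=\{\mathcal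 W_\varepsilon(m,x):(m,x)\in\mathcal E\}$ of subsets of $\mathcal E$ satisfying (1) and (2), and it has the following properties. (1) $(m,x)\in\mathcal W_\varepsilon(m,x)$, and $\mathcal W_\varepsilon(m,x)$ is, through $\varphi^m$, the graph of a Lipschitz map $\mathcal F_m(\varepsilon)\to\mathcal E_m$, with a Lipschitz constant independent of $(m,x)$. (2) $H\,\mathcal W_\varepsilon(m,x)\subset\mathcal W_\varepsilon(H(m,x))$. The family is a local partition: if $(m',x')\in\mathcal W_\varepsilon(m,x)$, then $\mathcal W_\varepsilon(m,x)$ and $\mathcal W_\varepsilon(m',x')$ coincide over $\mathcal F_m(\varepsilon)\cap\mathcal F_{m'}(\varepsilon)$. (3) For $d(m_1,m_2)<\varepsilon$ let $h_{m_1,m_2}(x)=y$ if $(m_2,y)\in\mathcal W_\varepsilon(m_1,x)$. Then $h_{m_1,m_2}:\mathcal E_{m_1}\to\mathcal E_{m_2}$ is continuous; for every $m$, $(m_1,m_2,x)\mapsto h_{m_1,m_2}(x)$, read in $\varphi^m$, is continuous for $m_1,m_2\in\mathcal F_m(\varepsilon)$ with $d(m_1,m_2)<\varepsilon$; and there is a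 constant $C$ with $d\big((\varphi^{m_1}_{m_2})^{-1}h_{m_1,m_2}(x),x\big)\le C\,d(m_1,m_2)$ for all such $m_1,m_2$ and all $x\in\mathcal E_{m_1}$. If $\sup_m\operatorname{Lip}H_m<\infty$, then there is $\theta\in(0,1]$ with $\sup_m(\operatorname{Lip}H_m)^\theta\operatorname{Lip}H_m^{-1}\,\lambda_s(m)<1$ such that the maps $h_{m_1,m_2}$, $d(m_1,m_2)<\varepsilon$, are $\theta$-Hölder, with a uniform constant, on pairs of points at distance at most $R$, for each $R$; if the fibers are uniformly bounded, they are $\theta$-Hölder on the whole fibers with a uniform constant. (4) The maps $h_{m_1,m_2}$, $d(m_1,m_2)<\varepsilon$, form a local holonomy for $H$: besides the continuity in (3), $h_{m,m}=\mathrm{id}$, $h_{m_2,m_3}\circ h_{m_1,m_2}=h_{m_1,m_3}$ when all three distances are less than $\varepsilon$, and $H_{m_2}\circ h_{m_1,m_2}=h_{\phi(m_1),\phi(m_2)}\circ H_{m_1}$. (5) If moreover $\sup_m\lambda_s(m)<1$, then the sets $\mathcal W(m,x)=\bigcup_{n\ge0}H^{-n}\mathcal W_\varepsilon(H^n(m,x))$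 contain $(m,x)$, form a partition of $\mathcal E$, and satisfy $H\,\mathcal W(m,x)\subset\mathcal W(H(m,x))$. If in addition the leaves are connected, then for all $m_1,m_2$ in one leaf and $x\in\mathcal E_{m_1}$ there is exactly one $y\in\mathcal E_{m_2}$ with $(m_2,y)\in\mathcal W(m_1,x)$; the maps $h_{m_1,m_2}(x)=y$ are continuous and satisfy the transition and invariance properties of (4) for all points of a leaf, and $(m_1,m_2,x)\mapsto h_{m_1,m_2}(x)$, read in $\varphi^m$, is continuous for $m_1,m_2\in\mathcal F_m(\varepsilon)$. -/

import Mathlib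

open Set Metric
open scoped NNReal

/-! A lamination with metric leaves is the disjoint union of its leaves. It is given here by its
leaf space `Λ` and the complete metric spaces `F ℓ`, `ℓ : Λ`; a point of the lamination is a pair of
a leaf `ℓ` and a point `m : F ℓ`, and the plaque of radius `r` at `m` is `Metric.ball m r`.
A bundle over the lamination with metric fibers is a family `E ℓ m` of complete metric spaces. -/

/-- A lamination map: it sends each leaf into a leaf. -/
structure LaminationMap {Λ : Type*} (F : Λ → Type*) where
  /-- the induced map on the leaf space -/
  onLeaves : Λ → Λ
  /-- the map on each leaf -/
  toFun : ∀ ℓ, F ℓ → F (onLeaves ℓ)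

/-- On every plaque of radius `ε` the map `φ` takes values in the plaque of radius `ε` at the image
of the center and is Lipschitz there with constant `lam`. -/
def LaminationMap.IsPlaqueLipschitz {Λ : Type*} {F : Λ → Type*} [∀ ℓ, MetricSpace (F ℓ)]
    (φ : LaminationMap F) (lam : ∀ ℓ, F ℓ → ℝ≥0) (ε : ℝ) : Prop :=
  ∀ (ℓ : Λ) (m : F ℓ),
    MapsTo (φ.toFun ℓ) (ball m ε) (ball (φ.toFun ℓ m) ε) ∧
      LipschitzOnWith (lam ℓ m) (φ.toFun ℓ) (ball m ε)

/-- The total space of a bundle `E` over the lamination; its points are written `⟨ℓ, m, x⟩`. -/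
abbrev LamTotal {Λ : Type*} {F : Λ → Type*} (E : ∀ ℓ, F ℓ → Type*) :=
  Σ ℓ, Σ m : F ℓ, E ℓ m

/-- A bundle map over `φ`, given by its fiber maps `H ℓ m : E_m → E_{φ(m)}`. -/
abbrev LamBundleMap {Λ : Type*} {F : Λ → Type*} (φ : LaminationMap F) (E : ∀ ℓ, F ℓ → Type*) :=
  ∀ (ℓ : Λ) (m : F ℓ), E ℓ m → E (φ.onLeaves ℓ) (φ.toFun ℓ m)

/-- The bundle map as a self-map of the total space: `(m, x) ↦ (φ m, H_m x)`. -/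
def LamBundleMap.total {Λ : Type*} {F : Λ → Type*} {φ : LaminationMap F} {E : ∀ ℓ, F ℓ → Type*}
    (H : LamBundleMap φ E) : LamTotal E → LamTotal E :=
  fun p => ⟨φ.onLeaves p.1, φ.toFun p.1 p.2.1, H p.1 p.2.1 p.2.2⟩

/-- A regular bundle atlas with one bundle chart at every point `m`, whose domain is the plaque of
radius `ε'`: `chart m m' : E_m → E_{m'}` is the fiber map at `m'` of the bundle chart at `m`, and
`chartInv m m'` is its inverse. The values for `m'` outside the plaque of `m` carry no
information. -/
structure PlaqueAtlas {Λ : Type*} {F : Λ → Type*} [∀ ℓ, MetricSpace (F ℓ)]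
    (E : ∀ ℓ, F ℓ → Type*) (ε' : ℝ) where
  chart : ∀ {ℓ : Λ} (m m' : F ℓ), E ℓ m → E ℓ m'
  chartInv : ∀ {ℓ : Λ} (m m' : F ℓ), E ℓ m' → E ℓ m
  chart_self : ∀ {ℓ : Λ} (m : F ℓ) (x : E ℓ m), chart m m x = x
  left_inv : ∀ {ℓ : Λ} (m m' : F ℓ), m' ∈ ball m ε' → ∀ x, chartInv m m' (chart m m' x) = x
  right_inv : ∀ {ℓ : Λ} (m m' : F ℓ), m' ∈ ball m ε' → ∀ y, chart m m' (chartInv m m' y) = y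

namespace PlaqueAtlas

variable {Λ : Type*} {F : Λ → Type*} [∀ ℓ, MetricSpace (F ℓ)]
  {E : ∀ ℓ, F ℓ → Type*} [∀ ℓ m, MetricSpace (E ℓ m)] {ε' : ℝ}

/-- `E` is a uniform `C^{0,1}`-fiber bundle with respect to the atlas `A`: the charts and their
inverses are Lipschitz in the fibers with constant `1 + η(d(m', m))`, with one modulus `η` that is
continuous and vanishes at `0`, and the transition maps are continuous. -/
def IsUniformLipFiber (A : PlaqueAtlas E ε') : Prop :=
  (∃ η : ℝ≥0 → ℝ≥0, Continuous η ∧ η 0 = 0 ∧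
    ∀ (ℓ : Λ) (m m' : F ℓ), m' ∈ ball m ε' →
      LipschitzWith (1 + η (nndist m' m)) (A.chart m m') ∧
        LipschitzWith (1 + η (nndist m' m)) (A.chartInv m m')) ∧
  ∀ (ℓ : Λ) (m₀ m₁ : F ℓ),
    ContinuousOn (fun p : F ℓ × E ℓ m₀ => A.chartInv m₁ p.1 (A.chart m₀ p.1 p.2))
      ((ball m₀ ε' ∩ ball m₁ ε') ×ˢ univ)

/-- The fiberwise maps `G ℓ m : E_{φ(m)} → E_m` depend in a uniformly `C^{0,1}` fashion on the base
points: their local representations with respect to the charts of `A` (the chart at `m₀` for `E_m`,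
the chart at `n₀` for `E_{φ(m)}`) are Lipschitz in `m`, with one constant for all charts and all
fiber points `y`. -/
def IsUniformlyLipInBase (A : PlaqueAtlas E ε') (φ : LaminationMap F)
    (G : ∀ (ℓ : Λ) (m : F ℓ), E (φ.onLeaves ℓ) (φ.toFun ℓ m) → E ℓ m) : Prop :=
  ∃ L : ℝ≥0, ∀ (ℓ : Λ) (m₀ : F ℓ) (n₀ : F (φ.onLeaves ℓ)) (y : E (φ.onLeaves ℓ) n₀),
    LipschitzOnWith L
      (fun m : F ℓ => A.chartInv m₀ m (G ℓ m (A.chart n₀ (φ.toFun ℓ m) y)))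
      {m | m ∈ ball m₀ ε' ∧ φ.toFun ℓ m ∈ ball n₀ ε'}

/-- Every `W (m, x)` contains `(m, x)` and is, through the chart at `m`, the graph over the plaque
of radius `ε` at `m` of a Lipschitz map into `E_m`; the Lipschitz constant is the same for all
`(m, x)`. -/
def IsLipGraphFamily (A : PlaqueAtlas E ε') (ε : ℝ) (W : LamTotal E → Set (LamTotal E)) : Prop :=
  ∃ L : ℝ≥0, ∀ (ℓ : Λ) (m : F ℓ) (x : E ℓ m),
    (⟨ℓ, m, x⟩ : LamTotal E) ∈ W ⟨ℓ, m, x⟩ ∧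
    ∃ f : F ℓ → E ℓ m, LipschitzOnWith L f (ball m ε) ∧
      W ⟨ℓ, m, x⟩ = {q | ∃ m' ∈ ball m ε, q = ⟨ℓ, m', A.chart m m' (f m')⟩}

/-- The family `h` of maps `E_{m₁} → E_{m₂}`, considered for the pairs `m₁, m₂` of points of one
leaf that satisfy `D`, is a holonomy over the lamination for `H`. For `D = True` this is a holonomy;
for `D` the relation `d(m₁, m₂) < ε` it is a local holonomy. -/
structure IsHolonomy (A : PlaqueAtlas E ε') {φ : LaminationMap F} (H : LamBundleMap φ E)
    (D : ∀ ℓ, F ℓ → F ℓ → Prop) (ε : ℝ)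
    (h : ∀ (ℓ : Λ) (m₁ m₂ : F ℓ), E ℓ m₁ → E ℓ m₂) : Prop where
  cont : ∀ (ℓ : Λ) (m₁ m₂ : F ℓ), D ℓ m₁ m₂ → Continuous (h ℓ m₁ m₂)
  /-- transition -/
  refl : ∀ (ℓ : Λ) (m : F ℓ) (x : E ℓ m), h ℓ m m x = x
  trans : ∀ (ℓ : Λ) (m₁ m₂ m₃ : F ℓ), D ℓ m₁ m₂ → D ℓ m₂ m₃ → D ℓ m₁ m₃ →
    ∀ x, h ℓ m₂ m₃ (h ℓ m₁ m₂ x) = h ℓ m₁ m₃ x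
  /-- invariance -/
  invariant : ∀ (ℓ : Λ) (m₁ m₂ : F ℓ), D ℓ m₁ m₂ → ∀ x,
    H ℓ m₂ (h ℓ m₁ m₂ x) = h (φ.onLeaves ℓ) (φ.toFun ℓ m₁) (φ.toFun ℓ m₂) (H ℓ m₁ x)
  /-- regularity: `(m₁, m₂, x) ↦ h_{m₁,m₂}(x)`, read in the chart at `m`, is continuous for
  `m₁, m₂` in the plaque at `m` -/
  regular : ∀ (ℓ : Λ) (m : F ℓ),
    ContinuousOn
      (fun p : F ℓ × F ℓ × E ℓ m => A.chartInv m p.2.1 (h ℓ p.1 p.2.1 (A.chart m p.1 p.2.2)))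
      {p | p.1 ∈ ball m ε ∧ p.2.1 ∈ ball m ε ∧ D ℓ p.1 p.2.1}

end PlaqueAtlas

/-- `H` maps every `W p` into `W (H p)`. -/
def LamBundleMap.Preserves {Λ : Type*} {F : Λ → Type*} {φ : LaminationMap F}
    {E : ∀ ℓ, F ℓ → Type*} (H : LamBundleMap φ E) (W : LamTotal E → Set (LamTotal E)) : Prop :=
  ∀ p, H.total '' W p ⊆ W (H.total p)

/-- The part of the bundle over the plaque of radius `ε` at the base point of `p`. -/
def overPlaque {Λ : Type*} {F : Λ → Type*} [∀ ℓ, MetricSpace (F ℓ)] {E : ∀ ℓ, F ℓ → Type*}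
    (ε : ℝ) (p : LamTotal E) : Set (LamTotal E) :=
  {q | ∃ m' ∈ ball p.2.1 ε, ∃ y : E p.1 m', q = ⟨p.1, m', y⟩}

/-- The sets `W p`, which lie over plaques of radius `ε`, form a local partition: each point lies in
its own set, and if `q ∈ W p` then `W p` and `W q` coincide over the intersection of their
plaques. -/
def IsLocalPartition {Λ : Type*} {F : Λ → Type*} [∀ ℓ, MetricSpace (F ℓ)] {E : ∀ ℓ, F ℓ → Type*}
    (ε : ℝ) (W : LamTotal E → Set (LamTotal E)) : Prop :=
  (∀ p, p ∈ W p ∧ W p ⊆ overPlaque ε p) ∧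
    ∀ p q, q ∈ W p → W p ∩ overPlaque ε q = W q ∩ overPlaque ε p

/-- `⋃ₙ H⁻ⁿ (W (Hⁿ p))`, with `H⁻ⁿ` the preimage under the `n`-th iterate. -/
def LamBundleMap.saturate {Λ : Type*} {F : Λ → Type*} {φ : LaminationMap F}
    {E : ∀ ℓ, F ℓ → Type*} (H : LamBundleMap φ E) (W : LamTotal E → Set (LamTotal E))
    (p : LamTotal E) : Set (LamTotal E) :=
  ⋃ n : ℕ, H.total^[n] ⁻¹' W (H.total^[n] p)

/-! The fiber maps are onto, since their ranges are open, closed and meet every component. So `Hinv`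
is a two-sided inverse, and the graph transform acts on transport maps by `h ↦ Hinv ∘ h ∘ H`.
Suppose two transports from `m₁` to `m₂` differ by at most `c * dist m₁ m₂`. After one transform
they differ by at most `c * ρ * dist m₁ m₂`: `φ` shrinks the base distance by `lam`, `Hinv`
stretches fibers by `K`, and `K * lam ≤ ρ < 1` (`dist_inv_le`).

The charts are an admissible start. The Lipschitz dependence of `Hinv` on the base makes them
invariant (`dist_inv_chart_le`) and transitive (`dist_chart_chart_le`) up to errors linear in the
base distance. Both errors decay like `ρ ^ n` under the transform, so the pulled back charts
converge uniformly to continuous maps that are exactly invariant and transitive. The same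
contraction gives uniqueness (`eq_localHolonomy`), and the graphs of the limit maps form the family
`W`.

Hölder continuity comes from stopping the iteration at a time adapted to the distance of the two
fiber points. If `φ` contracts the leaves, iterates of `H` bring any two consecutive local relations
into one plaque. Eventual relatedness is then transitive, and transport propagates over connected
leaves. -/

open Filter Topology

/-! ### Surjectivity of the fiber maps -/

/-- A map with a continuous left inverse whose range is open and meets every connected component is
surjective. -/
theorem surjective_of_isOpen_range_of_leftInverse {X Y : Type*} [TopologicalSpace X]
    [TopologicalSpace Y] [T2Space Y] {f : X → Y} {g : Y → X} (hf : Continuous f)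
    (hg : Continuous g) (hgf : Function.LeftInverse g f) (ho : IsOpen (range f))
    (hc : ∀ y, ∃ x, f x ∈ connectedComponent y) : Function.Surjective f := by
  intro y
  have hcl : IsClosed (range f) := by
    have : range f = {y | f (g y) = y} := by
      ext z
      constructor
      · rintro ⟨x, rfl⟩
        exact congrArg f (hgf x)
      · exact fun hz => ⟨g z, hz⟩
    rw [this]
    exact isClosed_eq (hf.comp hg) continuous_id
  obtain ⟨x, hx⟩ := hc y
  have hcp : IsClopen (range f) := ⟨hcl, ho⟩
  have := hcp.connectedComponent_subset (mem_range_self x)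
  rw [← connectedComponent_eq hx] at this
  exact this mem_connectedComponent

/-! ### Pulled back charts and their limit -/

section

variable {Λ : Type*} {F : Λ → Type*} [∀ ℓ, MetricSpace (F ℓ)]
  {E : ∀ ℓ, F ℓ → Type*} [∀ ℓ m, MetricSpace (E ℓ m)]
  {φ : LaminationMap F} {ε' : ℝ}

/-- The approximations of the local holonomy: the charts, pulled back `n` times by the bundle
map. -/
def PlaqueAtlas.pullback (A : PlaqueAtlas E ε') (H : LamBundleMap φ E)
    (Hinv : ∀ (ℓ : Λ) (m : F ℓ), E (φ.onLeaves ℓ) (φ.toFun ℓ m) → E ℓ m) :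
    ℕ → ∀ (ℓ : Λ) (m₁ m₂ : F ℓ), E ℓ m₁ → E ℓ m₂
  | 0, _, m₁, m₂, x => A.chart m₁ m₂ x
  | n + 1, ℓ, m₁, m₂, x =>
    Hinv ℓ m₂ (pullback A H Hinv n (φ.onLeaves ℓ) (φ.toFun ℓ m₁) (φ.toFun ℓ m₂) (H ℓ m₁ x))

/-- The local holonomy, as the limit of its approximations. -/
noncomputable def PlaqueAtlas.localHolonomy [∀ ℓ m, Nonempty (E ℓ m)] (A : PlaqueAtlas E ε')
    (H : LamBundleMap φ E)
    (Hinv : ∀ (ℓ : Λ) (m : F ℓ), E (φ.onLeaves ℓ) (φ.toFun ℓ m) → E ℓ m)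
    (ℓ : Λ) (m₁ m₂ : F ℓ) (x : E ℓ m₁) : E ℓ m₂ :=
  limUnder atTop fun n => A.pullback H Hinv n ℓ m₁ m₂ x

/-- The bundle map `H`, with fiberwise inverse `Hinv`, is bunched on the scale `ε`. -/
structure IsBunchedBundleMap (A : PlaqueAtlas E ε') (H : LamBundleMap φ E)
    (Hinv : ∀ (ℓ : Λ) (m : F ℓ), E (φ.onLeaves ℓ) (φ.toFun ℓ m) → E ℓ m)
    (lam K : ∀ ℓ, F ℓ → ℝ≥0) (L ρ : ℝ≥0) (ε : ℝ) : Prop where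
  eps_pos : 0 < ε
  eps_le : ε ≤ ε'
  plaque : φ.IsPlaqueLipschitz lam ε
  lipschitz_chart : ∀ (ℓ : Λ) (m m' : F ℓ), dist m m' < ε → LipschitzWith 2 (A.chart m m')
  lipschitz_chartInv : ∀ (ℓ : Λ) (m m' : F ℓ), dist m m' < ε → LipschitzWith 2 (A.chartInv m m')
  continuous : ∀ (ℓ : Λ) (m : F ℓ), Continuous (H ℓ m)
  inv_apply : ∀ (ℓ : Λ) (m : F ℓ) (x : E ℓ m), Hinv ℓ m (H ℓ m x) = x
  apply_inv : ∀ (ℓ : Λ) (m : F ℓ) (y : E (φ.onLeaves ℓ) (φ.toFun ℓ m)),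
    H ℓ m (Hinv ℓ m y) = y
  lipschitz_inv : ∀ (ℓ : Λ) (m : F ℓ), LipschitzWith (K ℓ m) (Hinv ℓ m)
  lipschitz_base : ∀ (ℓ : Λ) (m₀ : F ℓ) (n₀ : F (φ.onLeaves ℓ)) (y : E (φ.onLeaves ℓ) n₀),
    LipschitzOnWith L
      (fun m : F ℓ => A.chartInv m₀ m (Hinv ℓ m (A.chart n₀ (φ.toFun ℓ m) y)))
      {m | m ∈ ball m₀ ε' ∧ φ.toFun ℓ m ∈ ball n₀ ε'}
  rate_lt_one : ρ < 1
  rate_le : ∀ (ℓ : Λ) (m : F ℓ), K ℓ m * lam ℓ m ≤ ρ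

namespace IsBunchedBundleMap

variable {A : PlaqueAtlas E ε'} {H : LamBundleMap φ E}
  {Hinv : ∀ (ℓ : Λ) (m : F ℓ), E (φ.onLeaves ℓ) (φ.toFun ℓ m) → E ℓ m}
  {lam K : ∀ ℓ, F ℓ → ℝ≥0} {L ρ : ℝ≥0} {ε : ℝ}
  (hB : IsBunchedBundleMap A H Hinv lam K L ρ ε)

include hB

theorem dist_map_lt {ℓ : Λ} {m₁ m₂ : F ℓ} (h : dist m₁ m₂ < ε) :
    dist (φ.toFun ℓ m₁) (φ.toFun ℓ m₂) < ε :=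
  (hB.plaque ℓ m₂).1 h

/-- The rate is taken at `m₂`, viewed as the center of the plaque, so that it meets the constant `K
ℓ m₂` of `Hinv ℓ m₂` in the bunching product. -/
theorem dist_map_le {ℓ : Λ} {m₁ m₂ : F ℓ} (h : dist m₁ m₂ < ε) :
    dist (φ.toFun ℓ m₁) (φ.toFun ℓ m₂) ≤ lam ℓ m₂ * dist m₁ m₂ :=
  (hB.plaque ℓ m₂).2.dist_le_mul _ h _ (mem_ball_self hB.eps_pos)

theorem mem_ball {ℓ : Λ} {m₁ m₂ : F ℓ} (h : dist m₁ m₂ < ε) : m₂ ∈ ball m₁ ε' := by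
  rw [dist_comm] at h
  exact h.trans_le hB.eps_le

theorem rate_mul_le (ℓ : Λ) (m : F ℓ) : (K ℓ m : ℝ) * lam ℓ m ≤ ρ := by
  exact_mod_cast hB.rate_le ℓ m

/-- One step of the contraction. -/
theorem dist_inv_le {ℓ : Λ} {m₁ m₂ : F ℓ} (h : dist m₁ m₂ < ε) {c : ℝ} (hc : 0 ≤ c)
    {y z : E (φ.onLeaves ℓ) (φ.toFun ℓ m₂)}
    (hyz : dist y z ≤ c * dist (φ.toFun ℓ m₁) (φ.toFun ℓ m₂)) :
    dist (Hinv ℓ m₂ y) (Hinv ℓ m₂ z) ≤ c * ρ * dist m₁ m₂ :=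
  calc dist (Hinv ℓ m₂ y) (Hinv ℓ m₂ z) ≤ K ℓ m₂ * dist y z := (hB.lipschitz_inv ℓ m₂).dist_le_mul _ _
    _ ≤ K ℓ m₂ * (c * (lam ℓ m₂ * dist m₁ m₂)) := by
        gcongr
        exact hyz.trans (mul_le_mul_of_nonneg_left (hB.dist_map_le h) hc)
    _ = c * (K ℓ m₂ * lam ℓ m₂) * dist m₁ m₂ := by ring
    _ ≤ c * ρ * dist m₁ m₂ := by
        gcongr
        exact hB.rate_mul_le ℓ m₂

theorem dist_chart_le {ℓ : Λ} {m₁ m₂ : F ℓ} (h : dist m₁ m₂ < ε) (x y : E ℓ m₁) :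
    dist (A.chart m₁ m₂ x) (A.chart m₁ m₂ y) ≤ 2 * dist x y := by
  simpa using (hB.lipschitz_chart ℓ m₁ m₂ h).dist_le_mul x y

theorem dist_chartInv_le {ℓ : Λ} {m₁ m₂ : F ℓ} (h : dist m₁ m₂ < ε) (x y : E ℓ m₂) :
    dist (A.chartInv m₁ m₂ x) (A.chartInv m₁ m₂ y) ≤ 2 * dist x y := by
  simpa using (hB.lipschitz_chartInv ℓ m₁ m₂ h).dist_le_mul x y

theorem chart_chartInv {ℓ : Λ} {m₁ m₂ : F ℓ} (h : dist m₁ m₂ < ε) (y : E ℓ m₂) :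
    A.chart m₁ m₂ (A.chartInv m₁ m₂ y) = y :=
  A.right_inv m₁ m₂ (hB.mem_ball h) y

theorem chartInv_chart {ℓ : Λ} {m₁ m₂ : F ℓ} (h : dist m₁ m₂ < ε) (x : E ℓ m₁) :
    A.chartInv m₁ m₂ (A.chart m₁ m₂ x) = x :=
  A.left_inv m₁ m₂ (hB.mem_ball h) x

/-- The chart at `m₀` moves points of the fibers almost as the pulled back chart at `φ m₁`. -/
theorem dist_inv_chart_le {ℓ : Λ} {m₀ m₁ m₂ : F ℓ} (h₁ : dist m₀ m₁ < ε) (h₂ : dist m₀ m₂ < ε)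
    (h₁₂ : dist m₁ m₂ < ε) (x : E ℓ m₀) :
    dist (Hinv ℓ m₂ (A.chart (φ.toFun ℓ m₁) (φ.toFun ℓ m₂) (H ℓ m₁ (A.chart m₀ m₁ x))))
      (A.chart m₀ m₂ x) ≤ 2 * L * dist m₁ m₂ := by
  have hε' := hB.eps_pos.trans_le hB.eps_le
  -- The local representation of `Hinv` at this fiber point takes the value `x` at `m₁`, where the
  -- chart at `φ m₁` is the identity and `Hinv` cancels `H`.
  have key := (hB.lipschitz_base ℓ m₀ (φ.toFun ℓ m₁) (H ℓ m₁ (A.chart m₀ m₁ x))).dist_le_mul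
    m₂ ⟨hB.mem_ball h₂, hB.mem_ball (hB.dist_map_lt h₁₂)⟩
    m₁ ⟨hB.mem_ball h₁, mem_ball_self hε'⟩
  simp only [A.chart_self, hB.inv_apply, hB.chartInv_chart h₁] at key
  have := hB.dist_chart_le h₂ (A.chartInv m₀ m₂ (Hinv ℓ m₂
    (A.chart (φ.toFun ℓ m₁) (φ.toFun ℓ m₂) (H ℓ m₁ (A.chart m₀ m₁ x))))) x
  rw [hB.chart_chartInv h₂] at this
  rw [dist_comm m₂ m₁] at key
  linarith

/-- The transition maps of the charts are uniformly Lipschitz in the base. -/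
theorem dist_chart_chart_le {ℓ : Λ} {m₁ m₂ m₃ : F ℓ} (h₁₂ : dist m₁ m₂ < ε)
    (h₂₃ : dist m₂ m₃ < ε) (h₁₃ : dist m₁ m₃ < ε) (x : E ℓ m₁) :
    dist (A.chart m₁ m₃ x) (A.chart m₂ m₃ (A.chart m₁ m₂ x)) ≤ 4 * L * dist m₂ m₃ := by
  -- Both ways to the fiber over `m₃` are compared with the same point, obtained by pulling back the
  -- chart at `φ m₂`. Each comparison costs `2 * L`.
  have h₁ := hB.dist_inv_chart_le h₁₂ h₁₃ h₂₃ x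
  have h₂ := hB.dist_inv_chart_le (by simpa using hB.eps_pos) h₂₃ h₂₃ (A.chart m₁ m₂ x)
  rw [A.chart_self] at h₂
  have := dist_triangle_left (A.chart m₁ m₃ x) (A.chart m₂ m₃ (A.chart m₁ m₂ x)) (Hinv ℓ m₃
    (A.chart (φ.toFun ℓ m₂) (φ.toFun ℓ m₃) (H ℓ m₂ (A.chart m₁ m₂ x))))
  linarith

theorem continuous_pullback (n : ℕ) : ∀ {ℓ : Λ} {m₁ m₂ : F ℓ}, dist m₁ m₂ < ε →
    Continuous (A.pullback H Hinv n ℓ m₁ m₂) := by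
  induction n with
  | zero => exact fun h => (hB.lipschitz_chart _ _ _ h).continuous
  | succ n ih =>
    exact fun h => (hB.lipschitz_inv _ _).continuous.comp
      ((ih (hB.dist_map_lt h)).comp (hB.continuous _ _))

theorem dist_pullback_succ_le (n : ℕ) : ∀ {ℓ : Λ} {m₁ m₂ : F ℓ}, dist m₁ m₂ < ε →
    ∀ x, dist (A.pullback H Hinv n ℓ m₁ m₂ x) (A.pullback H Hinv (n + 1) ℓ m₁ m₂ x) ≤
      2 * L * (ρ : ℝ) ^ n * dist m₁ m₂ := by
  induction n with
  | zero =>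
    intro ℓ m₁ m₂ h x
    have := hB.dist_inv_chart_le (by simpa using hB.eps_pos) h h x
    rw [A.chart_self, dist_comm] at this
    simpa [PlaqueAtlas.pullback] using this
  | succ n ih =>
    intro ℓ m₁ m₂ h x
    rw [pow_succ, ← mul_assoc (2 * (L : ℝ))]
    exact hB.dist_inv_le h (by positivity) (ih (hB.dist_map_lt h) _)

/-- The approximations are almost transitive. -/
theorem dist_pullback_trans_le (n : ℕ) : ∀ {ℓ : Λ} {m₁ m₂ m₃ : F ℓ}, dist m₁ m₂ < ε →
    dist m₂ m₃ < ε → dist m₁ m₃ < ε → ∀ x,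
    dist (A.pullback H Hinv n ℓ m₁ m₃ x)
      (A.pullback H Hinv n ℓ m₂ m₃ (A.pullback H Hinv n ℓ m₁ m₂ x)) ≤
      4 * L * (ρ : ℝ) ^ n * dist m₂ m₃ := by
  induction n with
  | zero =>
    intro ℓ m₁ m₂ m₃ h₁₂ h₂₃ h₁₃ x
    simpa [PlaqueAtlas.pullback] using hB.dist_chart_chart_le h₁₂ h₂₃ h₁₃ x
  | succ n ih =>
    intro ℓ m₁ m₂ m₃ h₁₂ h₂₃ h₁₃ x
    rw [pow_succ, ← mul_assoc (4 * (L : ℝ))]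
    refine hB.dist_inv_le h₂₃ (by positivity) ?_
    -- Surjectivity enters here: between the two transports `H` must cancel `Hinv`.
    rw [PlaqueAtlas.pullback, hB.apply_inv]
    exact ih (hB.dist_map_lt h₁₂) (hB.dist_map_lt h₂₃) (hB.dist_map_lt h₁₃) _

theorem one_sub_rate_pos : 0 < 1 - (ρ : ℝ) := sub_pos.2 (by exact_mod_cast hB.rate_lt_one)

theorem displacement_nonneg : 0 ≤ 2 * (L : ℝ) / (1 - ρ) :=
  div_nonneg (by positivity) hB.one_sub_rate_pos.le

variable [∀ ℓ m, Nonempty (E ℓ m)] [∀ ℓ m, CompleteSpace (E ℓ m)]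

theorem tendsto_pullback {ℓ : Λ} {m₁ m₂ : F ℓ} (h : dist m₁ m₂ < ε) (x : E ℓ m₁) :
    Tendsto (fun n => A.pullback H Hinv n ℓ m₁ m₂ x) atTop
      (𝓝 (A.localHolonomy H Hinv ℓ m₁ m₂ x)) := by
  have hc : CauchySeq fun n => A.pullback H Hinv n ℓ m₁ m₂ x := by
    refine cauchySeq_of_le_geometric (ρ : ℝ) (2 * L * dist m₁ m₂) hB.rate_lt_one fun n => ?_
    rw [mul_right_comm]
    exact hB.dist_pullback_succ_le n h x
  exact hc.tendsto_limUnder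

theorem dist_pullback_localHolonomy_le (n : ℕ) {ℓ : Λ} {m₁ m₂ : F ℓ} (h : dist m₁ m₂ < ε)
    (x : E ℓ m₁) :
    dist (A.pullback H Hinv n ℓ m₁ m₂ x) (A.localHolonomy H Hinv ℓ m₁ m₂ x) ≤
      2 * L * dist m₁ m₂ * (ρ : ℝ) ^ n / (1 - ρ) := by
  refine dist_le_of_le_geometric_of_tendsto (ρ : ℝ) (2 * L * dist m₁ m₂) hB.rate_lt_one
    (fun k => ?_) (hB.tendsto_pullback h x) n
  rw [mul_right_comm]
  exact hB.dist_pullback_succ_le k h x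

theorem dist_chart_localHolonomy_le {ℓ : Λ} {m₁ m₂ : F ℓ} (h : dist m₁ m₂ < ε) (x : E ℓ m₁) :
    dist (A.chart m₁ m₂ x) (A.localHolonomy H Hinv ℓ m₁ m₂ x) ≤
      2 * L / (1 - ρ) * dist m₁ m₂ := by
  have := hB.dist_pullback_localHolonomy_le 0 h x
  rw [PlaqueAtlas.pullback, pow_zero] at this
  exact this.trans_eq (by ring)

/-- The geometric error bound does not involve the fiber point. Uniformity gives continuity of the
limit and allows passing to the limit in compositions. -/
theorem tendstoUniformly_pullback {ℓ : Λ} {m₁ m₂ : F ℓ} (h : dist m₁ m₂ < ε) :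
    TendstoUniformly (fun n => A.pullback H Hinv n ℓ m₁ m₂) (A.localHolonomy H Hinv ℓ m₁ m₂)
      atTop := by
  rw [Metric.tendstoUniformly_iff]
  intro δ hδ
  have : Tendsto (fun n : ℕ => 2 * L * dist m₁ m₂ * (ρ : ℝ) ^ n / (1 - ρ)) atTop (𝓝 0) := by
    have := ((tendsto_pow_atTop_nhds_zero_of_lt_one ρ.coe_nonneg
      (by exact_mod_cast hB.rate_lt_one : (ρ : ℝ) < 1)).const_mul
        (2 * L * dist m₁ m₂)).div_const (1 - (ρ : ℝ))
    simpa using this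
  filter_upwards [this.eventually (gt_mem_nhds hδ)] with n hn x
  rw [dist_comm]
  exact (hB.dist_pullback_localHolonomy_le n h x).trans_lt hn

theorem continuous_localHolonomy {ℓ : Λ} {m₁ m₂ : F ℓ} (h : dist m₁ m₂ < ε) :
    Continuous (A.localHolonomy H Hinv ℓ m₁ m₂) :=
  (hB.tendstoUniformly_pullback h).continuous
    (Frequently.of_forall fun n => hB.continuous_pullback n h)

theorem localHolonomy_eq_inv {ℓ : Λ} {m₁ m₂ : F ℓ} (h : dist m₁ m₂ < ε) (x : E ℓ m₁) :
    A.localHolonomy H Hinv ℓ m₁ m₂ x = Hinv ℓ m₂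
      (A.localHolonomy H Hinv (φ.onLeaves ℓ) (φ.toFun ℓ m₁) (φ.toFun ℓ m₂) (H ℓ m₁ x)) :=
  tendsto_nhds_unique ((hB.tendsto_pullback h x).comp (tendsto_add_atTop_nat 1))
    (((hB.lipschitz_inv ℓ m₂).continuous.tendsto _).comp
      (hB.tendsto_pullback (hB.dist_map_lt h) (H ℓ m₁ x)))

theorem apply_localHolonomy {ℓ : Λ} {m₁ m₂ : F ℓ} (h : dist m₁ m₂ < ε) (x : E ℓ m₁) :
    H ℓ m₂ (A.localHolonomy H Hinv ℓ m₁ m₂ x) =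
      A.localHolonomy H Hinv (φ.onLeaves ℓ) (φ.toFun ℓ m₁) (φ.toFun ℓ m₂) (H ℓ m₁ x) := by
  rw [hB.localHolonomy_eq_inv h, hB.apply_inv]

theorem localHolonomy_self {ℓ : Λ} (m : F ℓ) (x : E ℓ m) :
    A.localHolonomy H Hinv ℓ m m x = x := by
  have := hB.dist_chart_localHolonomy_le (by simpa using hB.eps_pos) x (m₂ := m)
  rw [A.chart_self, dist_self, mul_zero] at this
  exact (dist_le_zero.1 this).symm

/-- The transitivity defect of the `n`-th approximations is of order `ρ ^ n`, and by uniform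
convergence their compositions tend to the composition of the limits. -/
theorem localHolonomy_trans {ℓ : Λ} {m₁ m₂ m₃ : F ℓ} (h₁₂ : dist m₁ m₂ < ε)
    (h₂₃ : dist m₂ m₃ < ε) (h₁₃ : dist m₁ m₃ < ε) (x : E ℓ m₁) :
    A.localHolonomy H Hinv ℓ m₂ m₃ (A.localHolonomy H Hinv ℓ m₁ m₂ x) =
      A.localHolonomy H Hinv ℓ m₁ m₃ x := by
  have hcomp : Tendsto (fun n => A.pullback H Hinv n ℓ m₂ m₃ (A.pullback H Hinv n ℓ m₁ m₂ x)) atTop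
      (𝓝 (A.localHolonomy H Hinv ℓ m₂ m₃ (A.localHolonomy H Hinv ℓ m₁ m₂ x))) :=
    (hB.tendstoUniformly_pullback h₂₃).tendsto_comp
      (hB.continuous_localHolonomy h₂₃).continuousAt (hB.tendsto_pullback h₁₂ x)
  have hdist : Tendsto (fun n => dist (A.pullback H Hinv n ℓ m₁ m₃ x)
      (A.pullback H Hinv n ℓ m₂ m₃ (A.pullback H Hinv n ℓ m₁ m₂ x))) atTop (𝓝 0) := by
    refine squeeze_zero (fun _ => dist_nonneg)
      (fun n => hB.dist_pullback_trans_le n h₁₂ h₂₃ h₁₃ x) ?_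
    have := ((tendsto_pow_atTop_nhds_zero_of_lt_one ρ.coe_nonneg
      (by exact_mod_cast hB.rate_lt_one : (ρ : ℝ) < 1)).const_mul
        (4 * (L : ℝ))).mul_const (dist m₂ m₃)
    simpa using this
  have := tendsto_nhds_unique ((hB.tendsto_pullback h₁₃ x).dist hcomp) hdist
  exact (dist_eq_zero.1 this).symm

theorem localHolonomy_symm {ℓ : Λ} {m₁ m₂ : F ℓ} (h : dist m₁ m₂ < ε) (x : E ℓ m₁) :
    A.localHolonomy H Hinv ℓ m₂ m₁ (A.localHolonomy H Hinv ℓ m₁ m₂ x) = x := by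
  rw [hB.localHolonomy_trans h (by rwa [dist_comm]) (by simpa using hB.eps_pos),
    hB.localHolonomy_self]

/-- The local holonomy is unique among the families of maps that are invariant and Lipschitz close
to the charts. -/
theorem eq_localHolonomy {k : ∀ (ℓ : Λ) (m₁ m₂ : F ℓ), E ℓ m₁ → E ℓ m₂} {C : ℝ} (hC : 0 ≤ C)
    (hk : ∀ (ℓ : Λ) (m₁ m₂ : F ℓ), dist m₁ m₂ < ε → ∀ x,
      dist (A.chart m₁ m₂ x) (k ℓ m₁ m₂ x) ≤ C * dist m₁ m₂)
    (hinv : ∀ (ℓ : Λ) (m₁ m₂ : F ℓ), dist m₁ m₂ < ε → ∀ x, H ℓ m₂ (k ℓ m₁ m₂ x) =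
      k (φ.onLeaves ℓ) (φ.toFun ℓ m₁) (φ.toFun ℓ m₂) (H ℓ m₁ x))
    {ℓ : Λ} {m₁ m₂ : F ℓ} (h : dist m₁ m₂ < ε) (x : E ℓ m₁) :
    k ℓ m₁ m₂ x = A.localHolonomy H Hinv ℓ m₁ m₂ x := by
  have key : ∀ n : ℕ, ∀ (ℓ : Λ) (m₁ m₂ : F ℓ), dist m₁ m₂ < ε → ∀ x,
      dist (A.pullback H Hinv n ℓ m₁ m₂ x) (k ℓ m₁ m₂ x) ≤ C * (ρ : ℝ) ^ n * dist m₁ m₂ := by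
    intro n
    induction n with
    | zero => simpa [PlaqueAtlas.pullback] using hk
    | succ n ih =>
      intro ℓ m₁ m₂ h x
      -- By invariance `k` is a fixed point of the graph transform, so each step contracts its
      -- distance to the approximations.
      have hfix := hinv ℓ m₁ m₂ h x
      rw [← hB.inv_apply ℓ m₂ (k ℓ m₁ m₂ x), hfix, pow_succ, ← mul_assoc C]
      exact hB.dist_inv_le h (by positivity) (ih _ _ _ (hB.dist_map_lt h) _)
  have hzero : Tendsto (fun n : ℕ => C * (ρ : ℝ) ^ n * dist m₁ m₂) atTop (𝓝 0) := by
    have := ((tendsto_pow_atTop_nhds_zero_of_lt_one ρ.coe_nonneg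
      (by exact_mod_cast hB.rate_lt_one : (ρ : ℝ) < 1)).const_mul C).mul_const (dist m₁ m₂)
    simpa using this
  have hd := squeeze_zero (fun _ => dist_nonneg) (fun n => key n ℓ m₁ m₂ h x) hzero
  exact (tendsto_nhds_unique (tendsto_iff_dist_tendsto_zero.2 hd) (hB.tendsto_pullback h x))

end IsBunchedBundleMap

end

/-! ### Regularity of the local holonomy -/

section

variable {Λ : Type*} {F : Λ → Type*} [∀ ℓ, MetricSpace (F ℓ)]
  {E : ∀ ℓ, F ℓ → Type*} [∀ ℓ m, MetricSpace (E ℓ m)]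
  {φ : LaminationMap F} {ε' : ℝ}

namespace IsBunchedBundleMap

variable {A : PlaqueAtlas E ε'} {H : LamBundleMap φ E}
  {Hinv : ∀ (ℓ : Λ) (m : F ℓ), E (φ.onLeaves ℓ) (φ.toFun ℓ m) → E ℓ m}
  {lam K : ∀ ℓ, F ℓ → ℝ≥0} {L ρ : ℝ≥0} {ε : ℝ}
  [∀ ℓ m, Nonempty (E ℓ m)] [∀ ℓ m, CompleteSpace (E ℓ m)]
  (hB : IsBunchedBundleMap A H Hinv lam K L ρ ε)

include hB

theorem dist_chartInv_localHolonomy_le {ℓ : Λ} {m₁ m₂ : F ℓ} (h : dist m₁ m₂ < ε) (x : E ℓ m₁) :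
    dist (A.chartInv m₁ m₂ (A.localHolonomy H Hinv ℓ m₁ m₂ x)) x ≤
      2 * (2 * L / (1 - ρ)) * dist m₁ m₂ := by
  have h₁ := hB.dist_chartInv_le h (A.localHolonomy H Hinv ℓ m₁ m₂ x) (A.chart m₁ m₂ x)
  rw [hB.chartInv_chart h, dist_comm _ (A.chart m₁ m₂ x)] at h₁
  have h₂ := hB.dist_chart_localHolonomy_le h x
  linarith

/-- In the chart at `m`, the local holonomy from `m` is Lipschitz on short distances. -/
theorem dist_chartInv_localHolonomy_le_of_dist_lt {ℓ : Λ} {m m₁ m₂ : F ℓ} (h₁ : dist m m₁ < ε)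
    (h₂ : dist m m₂ < ε) (h₁₂ : dist m₁ m₂ < ε) (x : E ℓ m) :
    dist (A.chartInv m m₁ (A.localHolonomy H Hinv ℓ m m₁ x))
      (A.chartInv m m₂ (A.localHolonomy H Hinv ℓ m m₂ x)) ≤
      2 * (2 * L / (1 - ρ) + 4 * L) * dist m₁ m₂ := by
  set u := A.localHolonomy H Hinv ℓ m m₁ x with hu
  have ht := hB.dist_chart_chart_le h₁ h₁₂ h₂ (A.chartInv m m₁ u)
  -- The point `chart m₁ m₂ u` is the intermediary: the charts are almost transitive, and by
  -- transitivity the holonomy from `m₁` takes `u` to the holonomy image of `x` over `m₂`.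
  rw [hB.chart_chartInv h₁] at ht
  have hd := hB.dist_chart_localHolonomy_le h₁₂ u
  rw [hu, hB.localHolonomy_trans h₁ h₁₂ h₂, ← hu] at hd
  have hc := hB.dist_chartInv_le h₂ (A.chart m m₂ (A.chartInv m m₁ u))
    (A.localHolonomy H Hinv ℓ m m₂ x)
  rw [hB.chartInv_chart h₂] at hc
  have := dist_triangle (A.chart m m₂ (A.chartInv m m₁ u)) (A.chart m₁ m₂ u)
    (A.localHolonomy H Hinv ℓ m m₂ x)
  linarith

theorem lipschitzOnWith_chartInv_localHolonomy {ℓ : Λ} (m : F ℓ) (x : E ℓ m) :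
    LipschitzOnWith (Real.toNNReal (4 * (2 * L / (1 - ρ) + 4 * L)))
      (fun m' => A.chartInv m m' (A.localHolonomy H Hinv ℓ m m' x)) (ball m ε) := by
  have hC := hB.displacement_nonneg
  refine LipschitzOnWith.of_dist_le_mul fun m₁ h₁ m₂ h₂ => ?_
  rw [mem_ball'] at h₁ h₂
  rw [Real.coe_toNNReal _ (by positivity)]
  -- Two points of the plaque may be up to `2 * ε` apart, out of reach of local transitivity. If
  -- they are at least `ε` apart, each is nearer to `m` than to the other, and the displacement
  -- bounds from `m` suffice; adding them produces the factor `4`.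
  rcases lt_or_ge (dist m₁ m₂) ε with h | h
  · refine (hB.dist_chartInv_localHolonomy_le_of_dist_lt h₁ h₂ h x).trans ?_
    gcongr
    norm_num
  · have k₁ := hB.dist_chartInv_localHolonomy_le h₁ x
    have k₂ := hB.dist_chartInv_localHolonomy_le h₂ x
    refine (dist_triangle_right _ _ x).trans ((add_le_add k₁ k₂).trans ?_)
    calc 2 * (2 * L / (1 - ρ)) * dist m m₁ + 2 * (2 * L / (1 - ρ)) * dist m m₂
        ≤ 2 * (2 * L / (1 - ρ)) * dist m₁ m₂ + 2 * (2 * L / (1 - ρ)) * dist m₁ m₂ := by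
          gcongr <;> linarith
      _ = 4 * (2 * L / (1 - ρ)) * dist m₁ m₂ := by ring
      _ ≤ 4 * (2 * L / (1 - ρ) + 4 * L) * dist m₁ m₂ := by
          gcongr
          exact le_add_of_nonneg_right (by positivity)

/-- The local holonomy from a plaque to its center, read in the chart at the center, is jointly
continuous. -/
theorem continuousOn_localHolonomy_chart {ℓ : Λ} (m : F ℓ) :
    ContinuousOn (fun p : F ℓ × E ℓ m => A.localHolonomy H Hinv ℓ p.1 m (A.chart m p.1 p.2))
      (ball m ε ×ˢ univ) := by
  rintro ⟨a, x₀⟩ ⟨ha, -⟩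
  replace ha : dist a m < ε := ha
  have ha' : dist m a < ε := by rwa [dist_comm]
  -- For base points near `a` the holonomy to `m` factors through `a`. Only the short first factor
  -- varies, and it is close to a chart; the second factor is one fixed continuous map.
  have hlim : Tendsto
      (fun p : F ℓ × E ℓ m => A.localHolonomy H Hinv ℓ p.1 a (A.chart m p.1 p.2))
      (𝓝[ball m ε ×ˢ univ] (a, x₀)) (𝓝 (A.chart m a x₀)) := by
    rw [tendsto_iff_dist_tendsto_zero]
    have hbound : Tendsto (fun p : F ℓ × E ℓ m =>
        2 * L / (1 - (ρ : ℝ)) * dist p.1 a + 4 * L * dist p.1 a + 2 * dist p.2 x₀)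
        (𝓝[ball m ε ×ˢ univ] (a, x₀)) (𝓝 0) := by
      have hc : Continuous (fun p : F ℓ × E ℓ m =>
        2 * L / (1 - (ρ : ℝ)) * dist p.1 a + 4 * L * dist p.1 a + 2 * dist p.2 x₀) := by fun_prop
      have := hc.tendsto (a, x₀)
      simp only [dist_self, mul_zero, add_zero] at this
      exact this.mono_left nhdsWithin_le_nhds
    refine squeeze_zero' (Eventually.of_forall fun _ => dist_nonneg) ?_ hbound
    have hnear : ∀ᶠ p : F ℓ × E ℓ m in 𝓝[ball m ε ×ˢ univ] (a, x₀), dist p.1 a < ε := by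
      have hc : Continuous fun p : F ℓ × E ℓ m => dist p.1 a := by fun_prop
      refine nhdsWithin_le_nhds (hc.tendsto (a, x₀) (gt_mem_nhds ?_))
      simpa using hB.eps_pos
    filter_upwards [hnear, self_mem_nhdsWithin] with p hp hpm
    have hpm' : dist m p.1 < ε := mem_ball'.1 hpm.1
    have k₁ := hB.dist_chart_localHolonomy_le hp (A.chart m p.1 p.2)
    have k₂ := hB.dist_chart_chart_le hpm' hp ha' p.2
    have k₃ := hB.dist_chart_le ha' p.2 x₀
    have t₁ := dist_triangle_left (A.localHolonomy H Hinv ℓ p.1 a (A.chart m p.1 p.2))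
      (A.chart m a p.2) (A.chart p.1 a (A.chart m p.1 p.2))
    have t₂ := dist_triangle (A.localHolonomy H Hinv ℓ p.1 a (A.chart m p.1 p.2))
      (A.chart m a p.2) (A.chart m a x₀)
    rw [dist_comm (A.chart p.1 a _) (A.chart m a p.2)] at t₁
    linarith
  refine (((hB.continuous_localHolonomy ha).tendsto _).comp hlim).congr' ?_
  have hnear : ∀ᶠ p : F ℓ × E ℓ m in 𝓝[ball m ε ×ˢ univ] (a, x₀), dist p.1 a < ε := by
    have hc : Continuous fun p : F ℓ × E ℓ m => dist p.1 a := by fun_prop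
    refine nhdsWithin_le_nhds (hc.tendsto (a, x₀) (gt_mem_nhds ?_))
    simpa using hB.eps_pos
  filter_upwards [hnear, self_mem_nhdsWithin] with p hp hpm
  exact hB.localHolonomy_trans hp ha hpm.1 _

/-- The local holonomy from the center of a plaque, read in the chart at the center, is jointly
continuous. -/
theorem continuousOn_chartInv_localHolonomy {ℓ : Λ} (m : F ℓ) :
    ContinuousOn (fun p : F ℓ × E ℓ m => A.chartInv m p.1 (A.localHolonomy H Hinv ℓ m p.1 p.2))
      (ball m ε ×ˢ univ) := by
  -- Continuity in the fiber point and a Lipschitz constant in the base that is uniform in the fiber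
  -- point give joint continuity.
  refine continuousOn_prod_of_continuousOn_lipschitzOnWith _ _ (fun a ha => ?_)
    fun x _ => hB.lipschitzOnWith_chartInv_localHolonomy m x
  have ha' : dist m a < ε := mem_ball'.1 ha
  exact ((hB.lipschitz_chartInv ℓ m a ha').continuous.comp
    (hB.continuous_localHolonomy ha')).continuousOn

/-- The holonomy over a plaque that passes through its center, read in the chart at the center, is
jointly continuous. -/
theorem continuousOn_chartInv_localHolonomy_comp {ℓ : Λ} (m : F ℓ) :
    ContinuousOn (fun p : F ℓ × F ℓ × E ℓ m => A.chartInv m p.2.1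
      (A.localHolonomy H Hinv ℓ m p.2.1
        (A.localHolonomy H Hinv ℓ p.1 m (A.chart m p.1 p.2.2))))
      {p | p.1 ∈ ball m ε ∧ p.2.1 ∈ ball m ε} := by
  have h₁ : ContinuousOn (fun p : F ℓ × F ℓ × E ℓ m =>
      (p.2.1, A.localHolonomy H Hinv ℓ p.1 m (A.chart m p.1 p.2.2)))
      {p | p.1 ∈ ball m ε ∧ p.2.1 ∈ ball m ε} := by
    refine ContinuousOn.prodMk (by fun_prop) ?_
    exact (hB.continuousOn_localHolonomy_chart m).comp
      (f := fun p : F ℓ × F ℓ × E ℓ m => (p.1, p.2.2)) (by fun_prop) fun p hp => ⟨hp.1, mem_univ _⟩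
  exact (hB.continuousOn_chartInv_localHolonomy m).comp h₁ fun p hp => ⟨hp.2, mem_univ _⟩

theorem isHolonomy_localHolonomy :
    A.IsHolonomy H (fun _ m₁ m₂ => dist m₁ m₂ < ε) ε (A.localHolonomy H Hinv) where
  cont _ _ _ h := hB.continuous_localHolonomy h
  refl _ m x := hB.localHolonomy_self m x
  trans _ _ _ _ h₁₂ h₂₃ h₁₃ x := hB.localHolonomy_trans h₁₂ h₂₃ h₁₃ x
  invariant _ _ _ h x := hB.apply_localHolonomy h x
  regular ℓ m := by
    refine ((hB.continuousOn_chartInv_localHolonomy_comp m).mono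
      (fun p hp => ⟨hp.1, hp.2.1⟩)).congr fun p hp => ?_
    simp only [hB.localHolonomy_trans hp.1 (mem_ball'.1 hp.2.1) hp.2.2]

/-- The first term does not vanish with `dist x y`, so this is no modulus of continuity yet. Each
pullback multiplies that term by `ρ` at the price of a larger factor on `dist x y`. -/
theorem dist_localHolonomy_le {ℓ : Λ} {m₁ m₂ : F ℓ} (h : dist m₁ m₂ < ε) (x y : E ℓ m₁) :
    dist (A.localHolonomy H Hinv ℓ m₁ m₂ x) (A.localHolonomy H Hinv ℓ m₁ m₂ y) ≤
      2 * (2 * L / (1 - ρ)) * dist m₁ m₂ + 2 * dist x y := by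
  have h₁ := hB.dist_chart_localHolonomy_le h x
  have h₂ := hB.dist_chart_localHolonomy_le h y
  have h₃ := hB.dist_chart_le h x y
  have := dist_triangle4_left (A.chart m₁ m₂ x) (A.chart m₁ m₂ y)
    (A.localHolonomy H Hinv ℓ m₁ m₂ x) (A.localHolonomy H Hinv ℓ m₁ m₂ y)
  linarith

/-- The estimate obtained from `dist_localHolonomy_le` by pulling back `n` times, when `H` and
`Hinv` are fiberwise Lipschitz with constants `S` and `B`. -/
theorem dist_localHolonomy_le_pow {B S : ℝ≥0} (hK : ∀ (ℓ : Λ) (m : F ℓ), K ℓ m ≤ B)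
    (hS : ∀ (ℓ : Λ) (m : F ℓ), LipschitzWith S (H ℓ m)) (n : ℕ) :
    ∀ {ℓ : Λ} {m₁ m₂ : F ℓ}, dist m₁ m₂ < ε → ∀ x y : E ℓ m₁,
    dist (A.localHolonomy H Hinv ℓ m₁ m₂ x) (A.localHolonomy H Hinv ℓ m₁ m₂ y) ≤
      2 * (2 * L / (1 - ρ)) * (ρ : ℝ) ^ n * dist m₁ m₂ + 2 * (B * S : ℝ) ^ n * dist x y := by
  induction n with
  | zero =>
    intro ℓ m₁ m₂ h x y
    simpa using hB.dist_localHolonomy_le h x y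
  | succ n ih =>
    intro ℓ m₁ m₂ h x y
    have hC := hB.displacement_nonneg
    rw [hB.localHolonomy_eq_inv h x, hB.localHolonomy_eq_inv h y]
    refine ((hB.lipschitz_inv ℓ m₂).dist_le_mul _ _).trans ((mul_le_mul_of_nonneg_left
      (ih (hB.dist_map_lt h) _ _) (NNReal.coe_nonneg _)).trans ?_)
    have hKB : (K ℓ m₂ : ℝ) ≤ B := by exact_mod_cast hK ℓ m₂
    have h₁ : (K ℓ m₂ : ℝ) * dist (φ.toFun ℓ m₁) (φ.toFun ℓ m₂) ≤ ρ * dist m₁ m₂ :=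
      calc (K ℓ m₂ : ℝ) * dist (φ.toFun ℓ m₁) (φ.toFun ℓ m₂)
          ≤ K ℓ m₂ * (lam ℓ m₂ * dist m₁ m₂) := by
            gcongr
            exact hB.dist_map_le h
        _ = K ℓ m₂ * lam ℓ m₂ * dist m₁ m₂ := by ring
        _ ≤ ρ * dist m₁ m₂ := by
            gcongr
            exact hB.rate_mul_le ℓ m₂
    have h₂ : (K ℓ m₂ : ℝ) * dist (H ℓ m₁ x) (H ℓ m₁ y) ≤ B * (S * dist x y) := by
      gcongr
      exact (hS ℓ m₁).dist_le_mul x y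
    calc (K ℓ m₂ : ℝ) * (2 * (2 * L / (1 - ρ)) * (ρ : ℝ) ^ n *
          dist (φ.toFun ℓ m₁) (φ.toFun ℓ m₂) +
          2 * (B * S : ℝ) ^ n * dist (H ℓ m₁ x) (H ℓ m₁ y))
        = 2 * (2 * L / (1 - ρ)) * (ρ : ℝ) ^ n *
            (K ℓ m₂ * dist (φ.toFun ℓ m₁) (φ.toFun ℓ m₂)) +
          2 * (B * S : ℝ) ^ n * (K ℓ m₂ * dist (H ℓ m₁ x) (H ℓ m₁ y)) := by ring
      _ ≤ 2 * (2 * L / (1 - ρ)) * (ρ : ℝ) ^ n * (ρ * dist m₁ m₂) +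
          2 * (B * S : ℝ) ^ n * (B * (S * dist x y)) := by gcongr
      _ = _ := by ring

end IsBunchedBundleMap

end

/-! ### Balancing the two terms: the Hölder exponent -/

/-- A quantity bounded by `a ρⁿ + b Qⁿ d` for all `n` is of order `d ^ θ` if `ρ (Q²) ^ θ ≤ 1`. -/
theorem le_rpow_of_forall_le_pow {ρ Q θ a b d D : ℝ} (hρ : 0 ≤ ρ) (hQ : 1 < Q) (hθ : 0 < θ)
    (hθ' : θ ≤ 1 / 2) (hρQ : ρ * (Q ^ 2) ^ θ ≤ 1) (ha : 0 ≤ a) (hb : 0 ≤ b) (hd : 0 < d)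
    (hd' : d ≤ 1) (hD : ∀ n : ℕ, D ≤ a * ρ ^ n + b * Q ^ n * d) :
    D ≤ (a * (Q ^ 2) ^ θ + b) * d ^ θ := by
  have hQ0 : 0 < Q := one_pos.trans hQ
  have hQ2 : 1 < Q ^ 2 := one_lt_pow₀ hQ two_ne_zero
  -- The stopping time satisfies `Q ^ (2 * n) ≤ 1 / d < Q ^ (2 * (n + 1))`. The right inequality
  -- makes `ρ ^ n` of order `d ^ θ`; the left one gives `Q ^ n * d ≤ d ^ (1 / 2)`, whence the
  -- restriction `θ ≤ 1 / 2`.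
  obtain ⟨n, hn, hn'⟩ := exists_nat_pow_near (one_le_one_div hd hd') hQ2
  have h₁ : ρ ^ n ≤ (Q ^ 2) ^ θ * d ^ θ := by
    have hlow : 1 ≤ (Q ^ 2) ^ (n + 1) * d := by
      rw [one_div, inv_eq_one_div, div_lt_iff₀ hd] at hn'
      exact hn'.le
    have hpow : 1 ≤ ((Q ^ 2) ^ θ) ^ (n + 1) * d ^ θ := by
      have := Real.one_le_rpow hlow hθ.le
      rwa [Real.mul_rpow (by positivity) hd.le, ← Real.rpow_natCast, ← Real.rpow_mul (by positivity),
        mul_comm _ θ, Real.rpow_mul (by positivity), Real.rpow_natCast] at this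
    have hle : (ρ * (Q ^ 2) ^ θ) ^ n ≤ 1 := pow_le_one₀ (by positivity) hρQ
    calc ρ ^ n ≤ ρ ^ n * (((Q ^ 2) ^ θ) ^ (n + 1) * d ^ θ) :=
          le_mul_of_one_le_right (by positivity) hpow
      _ = (ρ * (Q ^ 2) ^ θ) ^ n * ((Q ^ 2) ^ θ * d ^ θ) := by rw [mul_pow]; ring
      _ ≤ (Q ^ 2) ^ θ * d ^ θ := mul_le_of_le_one_left (by positivity) hle
  have h₂ : Q ^ n * d ≤ d ^ θ := by
    have hsq : (Q ^ n * d) ^ 2 ≤ (d ^ (1 / 2 : ℝ)) ^ 2 := by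
      rw [← Real.rpow_natCast (d ^ (1 / 2 : ℝ)), ← Real.rpow_mul hd.le]
      norm_num
      rw [← pow_mul, mul_comm 2 n, pow_mul] at hn
      rw [le_div_iff₀ hd] at hn
      nlinarith
    exact (le_of_sq_le_sq hsq (by positivity)).trans (Real.rpow_le_rpow_of_exponent_ge hd hd' hθ')
  calc D ≤ a * ρ ^ n + b * (Q ^ n * d) := by rw [← mul_assoc]; exact hD n
    _ ≤ a * ((Q ^ 2) ^ θ * d ^ θ) + b * d ^ θ := by gcongr
    _ = _ := by ring

/-- As `θ` tends to `0` from above, `ρ * Q ^ θ` tends to `ρ < 1`. -/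
theorem exists_rpow_mul_lt_one {Q ρ : ℝ} (hQ : 0 < Q) (hρ : ρ < 1) :
    ∃ θ : ℝ, 0 < θ ∧ θ ≤ 1 / 2 ∧ ρ * Q ^ θ < 1 := by
  have hc : Tendsto (fun θ : ℝ => ρ * Q ^ θ) (𝓝[>] 0) (𝓝 (ρ * Q ^ (0 : ℝ))) :=
    ((Real.continuous_const_rpow hQ.ne').tendsto 0 |>.const_mul ρ).mono_left nhdsWithin_le_nhds
  rw [Real.rpow_zero, mul_one] at hc
  have h₁ : ∀ᶠ θ : ℝ in 𝓝[>] 0, θ ∈ Ioc (0 : ℝ) (1 / 2) := Ioc_mem_nhdsGT (by norm_num)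
  obtain ⟨θ, hθ, hθ'⟩ := (h₁.and (hc.eventually (gt_mem_nhds hρ))).exists
  exact ⟨θ, hθ.1, hθ.2, hθ'⟩

/-! ### Hölder holonomy, invariant graphs and the global partition -/

section

variable {Λ : Type*} {F : Λ → Type*} [∀ ℓ, MetricSpace (F ℓ)]
  {E : ∀ ℓ, F ℓ → Type*} [∀ ℓ m, MetricSpace (E ℓ m)]
  {φ : LaminationMap F} {ε' : ℝ}

/-- The graph over the plaque of radius `r` that is obtained by transporting a point by `h`. -/
def holonomyGraph {Λ : Type*} {F : Λ → Type*} [∀ ℓ, MetricSpace (F ℓ)] {E : ∀ ℓ, F ℓ → Type*}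
    (h : ∀ (ℓ : Λ) (m₁ m₂ : F ℓ), E ℓ m₁ → E ℓ m₂) (r : ℝ) (p : LamTotal E) :
    Set (LamTotal E) :=
  {q | ∃ m', dist p.2.1 m' < r ∧ q = ⟨p.1, m', h p.1 p.2.1 m' p.2.2⟩}

theorem mk_mem_holonomyGraph {Λ : Type*} {F : Λ → Type*} [∀ ℓ, MetricSpace (F ℓ)]
    {E : ∀ ℓ, F ℓ → Type*} {h : ∀ (ℓ : Λ) (m₁ m₂ : F ℓ), E ℓ m₁ → E ℓ m₂} {r : ℝ} {ℓ : Λ}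
    {m₁ m₂ : F ℓ} {x : E ℓ m₁} {y : E ℓ m₂} :
    (⟨ℓ, m₂, y⟩ : LamTotal E) ∈ holonomyGraph h r ⟨ℓ, m₁, x⟩ ↔
      dist m₁ m₂ < r ∧ h ℓ m₁ m₂ x = y := by
  constructor
  · rintro ⟨m', hm', heq⟩
    cases heq
    exact ⟨hm', rfl⟩
  · rintro ⟨hm, rfl⟩
    exact ⟨m₂, hm, rfl⟩

namespace IsBunchedBundleMap

variable {A : PlaqueAtlas E ε'} {H : LamBundleMap φ E}
  {Hinv : ∀ (ℓ : Λ) (m : F ℓ), E (φ.onLeaves ℓ) (φ.toFun ℓ m) → E ℓ m}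
  {lam K : ∀ ℓ, F ℓ → ℝ≥0} {L ρ : ℝ≥0} {ε : ℝ}
  [∀ ℓ m, Nonempty (E ℓ m)] [∀ ℓ m, CompleteSpace (E ℓ m)]
  (hB : IsBunchedBundleMap A H Hinv lam K L ρ ε)

include hB

theorem exists_holder {B S : ℝ≥0} (hK : ∀ (ℓ : Λ) (m : F ℓ), K ℓ m ≤ B)
    (hS : ∀ (ℓ : Λ) (m : F ℓ), LipschitzWith S (H ℓ m)) :
    ∃ θ : ℝ, 0 < θ ∧ θ ≤ 1 ∧ (S : ℝ) ^ θ * ρ < 1 ∧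
      ∀ R : ℝ, ∃ C : ℝ, ∀ (ℓ : Λ) (m₁ m₂ : F ℓ), dist m₁ m₂ < ε → ∀ x y : E ℓ m₁, dist x y ≤ R →
        dist (A.localHolonomy H Hinv ℓ m₁ m₂ x) (A.localHolonomy H Hinv ℓ m₁ m₂ y) ≤
          C * dist x y ^ θ := by
  have hC := hB.displacement_nonneg
  have hε := hB.eps_pos
  -- This `Q` exceeds `1` and dominates the growth factor `B * S`; also `S ≤ Q ^ 2`, so the bound
  -- for `ρ * (Q ^ 2) ^ θ` covers `S ^ θ * ρ`.
  set Q : ℝ := B * S + S + 2 with hQ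
  have hBS : 0 ≤ (B * S : ℝ) := by positivity
  have hS0 : 0 ≤ (S : ℝ) := S.coe_nonneg
  have hQ1 : 1 < Q := by linarith
  obtain ⟨θ, hθ, hθ', hρQ⟩ :=
    exists_rpow_mul_lt_one (pow_pos (one_pos.trans hQ1) 2) (NNReal.coe_lt_one.2 hB.rate_lt_one)
  refine ⟨θ, hθ, by linarith, ?_, fun R => ?_⟩
  · refine lt_of_le_of_lt ?_ hρQ
    rw [mul_comm]
    gcongr
    nlinarith
  set a : ℝ := 2 * (2 * L / (1 - ρ)) * ε with ha
  have ha0 : 0 ≤ a := by positivity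
  refine ⟨(a * (Q ^ 2) ^ θ + 2) + (a + 2 * |R|), fun ℓ m₁ m₂ h x y hxy => ?_⟩
  have hpow : ∀ n : ℕ,
      dist (A.localHolonomy H Hinv ℓ m₁ m₂ x) (A.localHolonomy H Hinv ℓ m₁ m₂ y) ≤
        a * (ρ : ℝ) ^ n + 2 * Q ^ n * dist x y := fun n => by
    refine (hB.dist_localHolonomy_le_pow hK hS n h x y).trans ?_
    rw [ha, mul_right_comm _ ε]
    gcongr
    linarith
  have hQθ : 0 ≤ (Q ^ 2) ^ θ := by positivity
  rcases eq_or_ne x y with rfl | hne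
  · rw [dist_self, dist_self]
    positivity
  have hd := dist_pos.2 hne
  rcases le_or_gt (dist x y) 1 with h1 | h1
  · refine (le_rpow_of_forall_le_pow ρ.coe_nonneg hQ1 hθ hθ' hρQ.le ha0 zero_le_two hd h1
      hpow).trans ?_
    exact mul_le_mul_of_nonneg_right (le_add_of_nonneg_right (by positivity)) (by positivity)
  -- Beyond distance `1` the estimate without pullback is enough, since `dist x y ^ θ ≥ 1`. Only
  -- here does the constant depend on `R`.
  · have h0 := hpow 0
    rw [pow_zero, pow_zero, mul_one, mul_one] at h0
    have hone : 1 ≤ dist x y ^ θ := Real.one_le_rpow h1.le hθ.le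
    calc dist (A.localHolonomy H Hinv ℓ m₁ m₂ x) (A.localHolonomy H Hinv ℓ m₁ m₂ y)
        ≤ a + 2 * |R| := by linarith [hxy.trans (le_abs_self R)]
      _ ≤ (a * (Q ^ 2) ^ θ + 2) + (a + 2 * |R|) := le_add_of_nonneg_left (by positivity)
      _ ≤ _ := le_mul_of_one_le_right (by positivity) hone

theorem self_mem_holonomyGraph {r : ℝ} (hr : 0 < r) (p : LamTotal E) :
    p ∈ holonomyGraph (A.localHolonomy H Hinv) r p := by
  obtain ⟨ℓ, m, x⟩ := p
  exact mk_mem_holonomyGraph.2 ⟨by simpa using hr, hB.localHolonomy_self m x⟩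

theorem symm_mem_holonomyGraph {r : ℝ} (hr : r ≤ ε) {p q : LamTotal E}
    (h : q ∈ holonomyGraph (A.localHolonomy H Hinv) r p) :
    p ∈ holonomyGraph (A.localHolonomy H Hinv) r q := by
  obtain ⟨ℓ, m, x⟩ := p
  obtain ⟨m', hm', rfl⟩ := h
  exact mk_mem_holonomyGraph.2
    ⟨by rwa [dist_comm], hB.localHolonomy_symm (hm'.trans_le hr) x⟩

/-- The condition on the radii keeps the two end points within `ε`, where local transitivity holds.
-/
theorem trans_mem_holonomyGraph {r s : ℝ} (hrs : r + s ≤ ε) (hr : 0 ≤ r) (hs : 0 ≤ s)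
    {p q t : LamTotal E} (hpq : q ∈ holonomyGraph (A.localHolonomy H Hinv) r p)
    (hqt : t ∈ holonomyGraph (A.localHolonomy H Hinv) s q) :
    t ∈ holonomyGraph (A.localHolonomy H Hinv) ε p := by
  obtain ⟨ℓ, m, x⟩ := p
  obtain ⟨m₁, h₁, rfl⟩ := hpq
  obtain ⟨m₂, h₂, rfl⟩ := hqt
  have h₁₂ : dist m m₂ < ε :=
    (dist_triangle m m₁ m₂).trans_lt ((add_lt_add h₁ h₂).trans_le hrs)
  exact mk_mem_holonomyGraph.2 ⟨h₁₂,
    (hB.localHolonomy_trans (h₁.trans_le (by linarith)) (h₂.trans_le (by linarith)) h₁₂ x).symm⟩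

theorem total_mem_holonomyGraph {p q : LamTotal E}
    (h : q ∈ holonomyGraph (A.localHolonomy H Hinv) ε p) :
    H.total q ∈ holonomyGraph (A.localHolonomy H Hinv) ε (H.total p) := by
  obtain ⟨ℓ, m, x⟩ := p
  obtain ⟨m', hm', rfl⟩ := h
  exact mk_mem_holonomyGraph.2 ⟨hB.dist_map_lt hm', (hB.apply_localHolonomy hm' x).symm⟩

theorem iterate_total_mem_holonomyGraph {p q : LamTotal E}
    (h : q ∈ holonomyGraph (A.localHolonomy H Hinv) ε p) (n : ℕ) :
    H.total^[n] q ∈ holonomyGraph (A.localHolonomy H Hinv) ε (H.total^[n] p) := by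
  induction n with
  | zero => exact h
  | succ n ih =>
    rw [Function.iterate_succ_apply', Function.iterate_succ_apply']
    exact hB.total_mem_holonomyGraph ih

theorem preserves_holonomyGraph : H.Preserves (holonomyGraph (A.localHolonomy H Hinv) ε) := by
  rintro p _ ⟨q, hq, rfl⟩
  exact hB.total_mem_holonomyGraph hq

theorem isLocalPartition_holonomyGraph :
    IsLocalPartition ε (holonomyGraph (A.localHolonomy H Hinv) ε) := by
  refine ⟨fun p => ⟨hB.self_mem_holonomyGraph hB.eps_pos p, ?_⟩, ?_⟩
  · rintro _ ⟨m', hm', rfl⟩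
    exact ⟨m', mem_ball'.2 hm', _, rfl⟩
  · rintro ⟨ℓ, m, x⟩ _ ⟨m', hm', rfl⟩
    replace hm' : dist m m' < ε := hm'
    ext q
    constructor
    · rintro ⟨⟨m₂, h₂, rfl⟩, m₂', h₂', y, heq⟩
      cases heq
      exact ⟨mk_mem_holonomyGraph.2 ⟨mem_ball'.1 h₂',
        hB.localHolonomy_trans hm' (mem_ball'.1 h₂') h₂ x⟩, m₂, mem_ball'.2 h₂, _, rfl⟩
    · rintro ⟨⟨m₂, h₂, rfl⟩, m₂', h₂', y, heq⟩
      cases heq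
      exact ⟨mk_mem_holonomyGraph.2 ⟨mem_ball'.1 h₂',
        (hB.localHolonomy_trans hm' h₂ (mem_ball'.1 h₂') x).symm⟩, m₂, mem_ball'.2 h₂, _, rfl⟩

theorem isLipGraphFamily_holonomyGraph :
    A.IsLipGraphFamily ε (holonomyGraph (A.localHolonomy H Hinv) ε) := by
  refine ⟨_, fun ℓ m x => ⟨hB.self_mem_holonomyGraph hB.eps_pos _, _,
    hB.lipschitzOnWith_chartInv_localHolonomy m x, ?_⟩⟩
  ext q
  constructor
  · rintro ⟨m', hm', rfl⟩
    exact ⟨m', mem_ball'.2 hm', by rw [hB.chart_chartInv hm']⟩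
  · rintro ⟨m', hm', rfl⟩
    rw [mem_ball'] at hm'
    rw [hB.chart_chartInv hm']
    exact mk_mem_holonomyGraph.2 ⟨hm', rfl⟩

/-- The graph maps, read through the charts, satisfy the hypotheses of `eq_localHolonomy`. They are
close to the charts because `f` is Lipschitz and equals `x` at the center, the factor `2` coming
from the charts. They are invariant because a graph has only one point over each base point. -/
theorem eq_holonomyGraph {W : LamTotal E → Set (LamTotal E)} (hW : A.IsLipGraphFamily ε W)
    (hH : H.Preserves W) : W = holonomyGraph (A.localHolonomy H Hinv) ε := by
  obtain ⟨C, hW⟩ := hW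
  choose hself f hf hWf using hW
  have hmem : ∀ {ℓ : Λ} {m₁ m₂ : F ℓ} {x : E ℓ m₁} {y : E ℓ m₂},
      (⟨ℓ, m₂, y⟩ : LamTotal E) ∈ W ⟨ℓ, m₁, x⟩ → A.chart m₁ m₂ (f ℓ m₁ x m₂) = y := by
    intro ℓ m₁ m₂ x y h
    rw [hWf] at h
    obtain ⟨m', hm', heq⟩ := h
    cases heq
    rfl
  have hcenter : ∀ (ℓ : Λ) (m : F ℓ) (x : E ℓ m), f ℓ m x m = x := fun ℓ m x => by
    rw [← A.chart_self m (f ℓ m x m), hmem (hself ℓ m x)]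
  have huniq : ∀ {ℓ : Λ} {m₁ m₂ : F ℓ}, dist m₁ m₂ < ε → ∀ x : E ℓ m₁,
      A.chart m₁ m₂ (f ℓ m₁ x m₂) = A.localHolonomy H Hinv ℓ m₁ m₂ x := by
    refine fun {ℓ m₁ m₂} h x => hB.eq_localHolonomy
      (k := fun ℓ m₁ m₂ x => A.chart m₁ m₂ (f ℓ m₁ x m₂)) (C := 2 * C) (by positivity) ?_ ?_ h x
    · intro ℓ m₁ m₂ h x
      have h₁ := hB.dist_chart_le h x (f ℓ m₁ x m₂)
      have h₂ := (hf ℓ m₁ x).dist_le_mul m₁ (mem_ball_self hB.eps_pos) m₂ (mem_ball'.2 h)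
      rw [hcenter] at h₂
      linarith
    · intro ℓ m₁ m₂ h x
      have hmemW : (⟨ℓ, m₂, A.chart m₁ m₂ (f ℓ m₁ x m₂)⟩ : LamTotal E) ∈ W ⟨ℓ, m₁, x⟩ := by
        rw [hWf]
        exact ⟨m₂, mem_ball'.2 h, rfl⟩
      exact (hmem (hH _ ⟨_, hmemW, rfl⟩)).symm
  funext ⟨ℓ, m, x⟩
  rw [hWf]
  ext q
  constructor
  · rintro ⟨m', hm', rfl⟩
    rw [mem_ball'] at hm'
    exact mk_mem_holonomyGraph.2 ⟨hm', (huniq hm' x).symm⟩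
  · rintro ⟨m', hm', rfl⟩
    exact ⟨m', mem_ball'.2 hm', by rw [huniq hm']⟩

theorem self_mem_saturate (p : LamTotal E) :
    p ∈ H.saturate (holonomyGraph (A.localHolonomy H Hinv) ε) p :=
  mem_iUnion.2 ⟨0, hB.self_mem_holonomyGraph hB.eps_pos p⟩

theorem symm_mem_saturate {p q : LamTotal E}
    (h : q ∈ H.saturate (holonomyGraph (A.localHolonomy H Hinv) ε) p) :
    p ∈ H.saturate (holonomyGraph (A.localHolonomy H Hinv) ε) q := by
  obtain ⟨n, hn⟩ := mem_iUnion.1 h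
  exact mem_iUnion.2 ⟨n, hB.symm_mem_holonomyGraph le_rfl hn⟩

theorem preserves_saturate :
    H.Preserves (H.saturate (holonomyGraph (A.localHolonomy H Hinv) ε)) := by
  rintro p _ ⟨q, hq, rfl⟩
  obtain ⟨n, hn⟩ := mem_iUnion.1 hq
  refine mem_iUnion.2 ⟨n, ?_⟩
  rw [mem_preimage, ← Function.iterate_succ_apply, ← Function.iterate_succ_apply,
    Function.iterate_succ_apply', Function.iterate_succ_apply']
  exact hB.total_mem_holonomyGraph hn

/-- A fiber meets each set of the global partition at most once. -/
theorem eq_of_mem_saturate {ℓ : Λ} {m : F ℓ} {x y : E ℓ m}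
    (h : (⟨ℓ, m, y⟩ : LamTotal E) ∈
      H.saturate (holonomyGraph (A.localHolonomy H Hinv) ε) ⟨ℓ, m, x⟩) : x = y := by
  obtain ⟨n, hn⟩ := mem_iUnion.1 h
  rw [mem_preimage] at hn
  clear h
  induction n generalizing ℓ with
  | zero =>
    have := (mk_mem_holonomyGraph.1 hn).2
    rwa [hB.localHolonomy_self] at this
  | succ n ih =>
    rw [Function.iterate_succ_apply, Function.iterate_succ_apply] at hn
    -- The images of both points lie in one fiber and are related one iterate earlier, so they agree
    -- by induction; injectivity of `H` brings this back.
    rw [← hB.inv_apply ℓ m x, ← hB.inv_apply ℓ m y]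
    exact congrArg _ (ih hn)

/-- If the leaves are contracted, the iterates of `H` bring related points together. -/
theorem iterate_total_mem_holonomyGraph_pow {σ : ℝ} (hσ : 0 < σ)
    (hlam : ∀ (ℓ : Λ) (m : F ℓ), (lam ℓ m : ℝ) ≤ σ) (hσ' : σ ≤ 1) {p q : LamTotal E}
    (h : q ∈ holonomyGraph (A.localHolonomy H Hinv) ε p) (n : ℕ) :
    H.total^[n] q ∈ holonomyGraph (A.localHolonomy H Hinv) (σ ^ n * ε) (H.total^[n] p) := by
  induction n with
  | zero => simpa using h
  | succ n ih =>
    rw [Function.iterate_succ_apply', Function.iterate_succ_apply']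
    generalize H.total^[n] p = p' at ih ⊢
    generalize H.total^[n] q = q' at ih ⊢
    obtain ⟨ℓ, m, x⟩ := p'
    obtain ⟨m', hm', rfl⟩ := ih
    replace hm' : dist m m' < σ ^ n * ε := hm'
    have hm'' : dist m m' < ε := hm'.trans_le
      (mul_le_of_le_one_left hB.eps_pos.le (pow_le_one₀ hσ.le hσ'))
    refine mk_mem_holonomyGraph.2 ⟨?_, (hB.apply_localHolonomy hm'' x).symm⟩
    calc dist (φ.toFun ℓ m) (φ.toFun ℓ m') ≤ lam ℓ m' * dist m m' := hB.dist_map_le hm''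
      _ ≤ σ * dist m m' := by
          gcongr
          exact hlam ℓ m'
      _ < σ * (σ ^ n * ε) := by gcongr
      _ = σ ^ (n + 1) * ε := by ring

/-- Local relations persist under `H`, so both hold at the common time `k + n`. After `j` more
iterates each lies in a plaque of radius at most `ε / 2`, and the two can be composed. -/
theorem trans_mem_saturate {σ : ℝ≥0} (hσ : σ < 1) (hlam : ∀ (ℓ : Λ) (m : F ℓ), lam ℓ m ≤ σ)
    {p q t : LamTotal E}
    (hpq : q ∈ H.saturate (holonomyGraph (A.localHolonomy H Hinv) ε) p)
    (hqt : t ∈ H.saturate (holonomyGraph (A.localHolonomy H Hinv) ε) q) :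
    t ∈ H.saturate (holonomyGraph (A.localHolonomy H Hinv) ε) p := by
  obtain ⟨n, hn⟩ := mem_iUnion.1 hpq
  obtain ⟨k, hk⟩ := mem_iUnion.1 hqt
  have hε := hB.eps_pos
  -- The maximum with `1 / 2` keeps the rate positive when `σ = 0`, as the strict radius estimates
  -- require.
  have hτ : (0 : ℝ) < max (σ : ℝ) (1 / 2) := lt_max_of_lt_right (by norm_num)
  have hτ' : max (σ : ℝ) (1 / 2) < 1 := max_lt (by exact_mod_cast hσ) (by norm_num)
  obtain ⟨j, hj⟩ := exists_pow_lt_of_lt_one (show (0 : ℝ) < 1 / 2 by norm_num) hτ'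
  have hlam' : ∀ (ℓ : Λ) (m : F ℓ), (lam ℓ m : ℝ) ≤ max (σ : ℝ) (1 / 2) := fun ℓ m =>
    le_max_of_le_left (by exact_mod_cast hlam ℓ m)
  have h₁ := hB.iterate_total_mem_holonomyGraph_pow hτ hlam' hτ'.le
    (hB.iterate_total_mem_holonomyGraph hn k) j
  have h₂ := hB.iterate_total_mem_holonomyGraph_pow hτ hlam' hτ'.le
    (hB.iterate_total_mem_holonomyGraph hk n) j
  simp only [← Function.iterate_add_apply] at h₁ h₂
  rw [add_comm n k] at h₂
  refine mem_iUnion.2 ⟨j + (k + n), hB.trans_mem_holonomyGraph ?_ ?_ ?_ h₁ h₂⟩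
  · nlinarith
  · positivity
  · positivity

theorem isPartition_saturate {σ : ℝ≥0} (hσ : σ < 1)
    (hlam : ∀ (ℓ : Λ) (m : F ℓ), lam ℓ m ≤ σ) :
    Setoid.IsPartition (range (H.saturate (holonomyGraph (A.localHolonomy H Hinv) ε))) := by
  constructor
  · rintro ⟨p, hp⟩
    exact notMem_empty p (hp ▸ hB.self_mem_saturate p)
  · intro q
    refine ⟨_, ⟨mem_range_self q, hB.self_mem_saturate q⟩, ?_⟩
    rintro _ ⟨⟨p, rfl⟩, hpq⟩
    ext t
    exact ⟨hB.trans_mem_saturate hσ hlam (hB.symm_mem_saturate hpq),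
      hB.trans_mem_saturate hσ hlam hpq⟩

/-- In a connected leaf the holonomy extends to all pairs of points. -/
theorem exists_continuous_mem_saturate {σ : ℝ≥0} (hσ : σ < 1)
    (hlam : ∀ (ℓ : Λ) (m : F ℓ), lam ℓ m ≤ σ) {ℓ : Λ} [PreconnectedSpace (F ℓ)] (m₁ m₂ : F ℓ) :
    ∃ g : E ℓ m₁ → E ℓ m₂, Continuous g ∧ ∀ x, (⟨ℓ, m₂, g x⟩ : LamTotal E) ∈
      H.saturate (holonomyGraph (A.localHolonomy H Hinv) ε) ⟨ℓ, m₁, x⟩ := by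
  have hlocal : ∀ m₁ m₂ : F ℓ, dist m₁ m₂ < ε →
      ∃ g : E ℓ m₁ → E ℓ m₂, Continuous g ∧ ∀ x, (⟨ℓ, m₂, g x⟩ : LamTotal E) ∈
        H.saturate (holonomyGraph (A.localHolonomy H Hinv) ε) ⟨ℓ, m₁, x⟩ := fun m₁ m₂ h =>
    ⟨_, hB.continuous_localHolonomy h, fun x =>
      mem_iUnion.2 ⟨0, mk_mem_holonomyGraph.2 ⟨h, rfl⟩⟩⟩
  -- The existence of a continuous transport is a transitive relation that holds in both directions
  -- between nearby points, hence between any two points of a connected leaf.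
  refine PreconnectedSpace.induction₂' (fun m₁ m₂ : F ℓ =>
    ∃ g : E ℓ m₁ → E ℓ m₂, Continuous g ∧ ∀ x, (⟨ℓ, m₂, g x⟩ : LamTotal E) ∈
      H.saturate (holonomyGraph (A.localHolonomy H Hinv) ε) ⟨ℓ, m₁, x⟩)
    (fun m => ?_) ⟨?_⟩ m₁ m₂
  · filter_upwards [ball_mem_nhds m hB.eps_pos] with m' hm'
    exact ⟨hlocal _ _ (mem_ball'.1 hm'), hlocal _ _ hm'⟩
  · rintro a b c ⟨g, hg, hgm⟩ ⟨k, hk, hkm⟩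
    exact ⟨k ∘ g, hk.comp hg, fun x => hB.trans_mem_saturate hσ hlam (hgm x) (hkm (g x))⟩

/-- A fiber meets each set of the partition at most once, so the transport is determined by
membership. Transition and invariance then follow from transitivity and invariance of the saturated
sets. -/
theorem exists_globalHolonomy {σ : ℝ≥0} (hσ : σ < 1) (hlam : ∀ (ℓ : Λ) (m : F ℓ), lam ℓ m ≤ σ)
    (hconn : ∀ ℓ, PreconnectedSpace (F ℓ)) :
    ∃ g : ∀ (ℓ : Λ) (m₁ m₂ : F ℓ), E ℓ m₁ → E ℓ m₂,
      (∀ (ℓ : Λ) (m₁ m₂ : F ℓ) (x : E ℓ m₁) (y : E ℓ m₂),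
        (⟨ℓ, m₂, y⟩ : LamTotal E) ∈
          H.saturate (holonomyGraph (A.localHolonomy H Hinv) ε) ⟨ℓ, m₁, x⟩ ↔ g ℓ m₁ m₂ x = y) ∧
      A.IsHolonomy H (fun _ _ _ => True) ε g := by
  choose g hg hgm using
    fun (ℓ : Λ) (m₁ m₂ : F ℓ) => hB.exists_continuous_mem_saturate hσ hlam m₁ m₂
  have hiff : ∀ (ℓ : Λ) (m₁ m₂ : F ℓ) (x : E ℓ m₁) (y : E ℓ m₂), (⟨ℓ, m₂, y⟩ : LamTotal E) ∈
      H.saturate (holonomyGraph (A.localHolonomy H Hinv) ε) ⟨ℓ, m₁, x⟩ ↔ g ℓ m₁ m₂ x = y := by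
    intro ℓ m₁ m₂ x y
    refine ⟨fun h => ?_, fun h => h ▸ hgm ℓ m₁ m₂ x⟩
    exact hB.eq_of_mem_saturate
      (hB.trans_mem_saturate hσ hlam (hB.symm_mem_saturate (hgm ℓ m₁ m₂ x)) h)
  have htrans : ∀ (ℓ : Λ) (m₁ m₂ m₃ : F ℓ) (x : E ℓ m₁),
      g ℓ m₂ m₃ (g ℓ m₁ m₂ x) = g ℓ m₁ m₃ x := fun ℓ m₁ m₂ m₃ x =>
    ((hiff _ _ _ _ _).1 (hB.trans_mem_saturate hσ hlam (hgm ℓ m₁ m₂ x) (hgm ℓ m₂ m₃ _))).symm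
  have hlocal : ∀ {ℓ : Λ} {m₁ m₂ : F ℓ}, dist m₁ m₂ < ε → ∀ x : E ℓ m₁,
      g ℓ m₁ m₂ x = A.localHolonomy H Hinv ℓ m₁ m₂ x := fun h x =>
    (hiff _ _ _ _ _).1 (mem_iUnion.2 ⟨0, mk_mem_holonomyGraph.2 ⟨h, rfl⟩⟩)
  refine ⟨g, hiff, fun ℓ m₁ m₂ _ => hg ℓ m₁ m₂, fun ℓ m x => ?_,
    fun ℓ m₁ m₂ m₃ _ _ _ x => htrans ℓ m₁ m₂ m₃ x, fun ℓ m₁ m₂ _ x => ?_, fun ℓ m => ?_⟩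
  · exact (hiff _ _ _ _ _).1 (hB.self_mem_saturate _)
  · exact ((hiff _ _ _ _ _).1
      (hB.preserves_saturate _ ⟨_, hgm ℓ m₁ m₂ x, rfl⟩)).symm
  · refine ((hB.continuousOn_chartInv_localHolonomy_comp m).mono
      (fun p hp => ⟨hp.1, hp.2.1⟩)).congr fun p hp => ?_
    simp only
    -- The two points may be farther apart than `ε`, but the factorization through the center of the
    -- plaque uses only local holonomies.
    rw [← htrans ℓ p.1 m p.2.1, hlocal hp.1, hlocal (mem_ball'.1 hp.2.1)]

end IsBunchedBundleMap

end

/-! ### Choice of the radius and conclusion -/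

/-- Near `0` the modulus `η` is below `1`, which turns the chart constants into the `2` used
throughout. -/
theorem exists_radius_of_isUniformLipFiber {Λ : Type*} {F : Λ → Type*} [∀ ℓ, MetricSpace (F ℓ)]
    {E : ∀ ℓ, F ℓ → Type*} [∀ ℓ m, MetricSpace (E ℓ m)] {ε' : ℝ} (hε' : 0 < ε')
    {A : PlaqueAtlas E ε'} (hA : A.IsUniformLipFiber) :
    ∃ ε₀ : ℝ, 0 < ε₀ ∧ ε₀ ≤ ε' ∧ ∀ (ℓ : Λ) (m m' : F ℓ), dist m m' < ε₀ →
      LipschitzWith 2 (A.chart m m') ∧ LipschitzWith 2 (A.chartInv m m') := by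
  obtain ⟨⟨η, hη, hη0, hLip⟩, -⟩ := hA
  have hev : ∀ᶠ t in 𝓝 (0 : ℝ≥0), η t < 1 :=
    (hη.tendsto 0).eventually (gt_mem_nhds (by rw [hη0]; exact one_pos))
  obtain ⟨δ, hδ, hball⟩ := Metric.eventually_nhds_iff.1 hev
  refine ⟨min δ ε', lt_min hδ hε', min_le_right _ _, fun ℓ m m' h => ?_⟩
  have hη1 : η (nndist m' m) < 1 := by
    refine hball ?_
    rw [NNReal.dist_eq, NNReal.coe_zero, sub_zero, abs_of_nonneg (NNReal.coe_nonneg _),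
      coe_nndist, dist_comm]
    exact h.trans_le (min_le_left _ _)
  have hle : 1 + η (nndist m' m) ≤ 2 := by
    rw [← one_add_one_eq_two]
    gcongr
  obtain ⟨h₁, h₂⟩ := hLip ℓ m m' (mem_ball'.2 (h.trans_le (min_le_right _ _)))
  exact ⟨h₁.weaken hle, h₂.weaken hle⟩

theorem theorem7p16 {Λ : Type*} {F : Λ → Type*}
    [∀ ℓ, MetricSpace (F ℓ)] [∀ ℓ, CompleteSpace (F ℓ)]
    {E : ∀ ℓ, F ℓ → Type*}
    [∀ ℓ m, MetricSpace (E ℓ m)] [∀ ℓ m, CompleteSpace (E ℓ m)] [∀ ℓ m, Nonempty (E ℓ m)]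
    -- the lamination map and its Lipschitz rates
    (φ : LaminationMap F) (lam : ∀ ℓ, F ℓ → ℝ≥0)
    (hlam : ∃ b : ℝ≥0, ∀ (ℓ : Λ) (m : F ℓ), lam ℓ m ≤ b)
    -- the uniform fiber bundle
    (ε' : ℝ) (hε' : 0 < ε') (A : PlaqueAtlas E ε') (hA : A.IsUniformLipFiber)
    -- the bundle map and its fiberwise left inverses
    (H : LamBundleMap φ E) (hH : ∀ (ℓ : Λ) (m : F ℓ), Continuous (H ℓ m))
    (Hinv : ∀ (ℓ : Λ) (m : F ℓ), E (φ.onLeaves ℓ) (φ.toFun ℓ m) → E ℓ m)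
    (hleft : ∀ (ℓ : Λ) (m : F ℓ), Function.LeftInverse (Hinv ℓ m) (H ℓ m))
    (hopen : ∀ (ℓ : Λ) (m : F ℓ), IsOpen (range (H ℓ m)))
    (hcomp : ∀ (ℓ : Λ) (m : F ℓ) (y : E (φ.onLeaves ℓ) (φ.toFun ℓ m)),
      ∃ x : E ℓ m, H ℓ m x ∈ connectedComponent y)
    (K : ∀ ℓ, F ℓ → ℝ≥0) (hK : ∀ (ℓ : Λ) (m : F ℓ), LipschitzWith (K ℓ m) (Hinv ℓ m))
    (hKb : ∃ b : ℝ≥0, ∀ (ℓ : Λ) (m : F ℓ), K ℓ m ≤ b)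
    (hbase : A.IsUniformlyLipInBase φ Hinv)
    -- the bunching condition
    (hbunch : ∃ ρ : ℝ≥0, ρ < 1 ∧ ∀ (ℓ : Λ) (m : F ℓ), K ℓ m * lam ℓ m ≤ ρ) :
    ∃ ε₀ : ℝ, 0 < ε₀ ∧ ε₀ ≤ ε' ∧ ∀ ε : ℝ, 0 < ε → ε < ε₀ → φ.IsPlaqueLipschitz lam ε →
      ∃ W : LamTotal E → Set (LamTotal E),
        -- a local partition into uniformly Lipschitz graphs that is invariant under `H`
        (IsLocalPartition ε W ∧ A.IsLipGraphFamily ε W ∧ H.Preserves W) ∧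
        -- uniqueness
        (∀ W' : LamTotal E → Set (LamTotal E),
          A.IsLipGraphFamily ε W' → H.Preserves W' → W' = W) ∧
        -- the local holonomy
        (∃ h : ∀ (ℓ : Λ) (m₁ m₂ : F ℓ), E ℓ m₁ → E ℓ m₂,
          (∀ (ℓ : Λ) (m₁ m₂ : F ℓ), dist m₁ m₂ < ε → ∀ (x : E ℓ m₁) (y : E ℓ m₂),
            (⟨ℓ, m₂, y⟩ : LamTotal E) ∈ W ⟨ℓ, m₁, x⟩ ↔ h ℓ m₁ m₂ x = y) ∧
          A.IsHolonomy H (fun _ m₁ m₂ => dist m₁ m₂ < ε) ε h ∧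
          (∃ C : ℝ, ∀ (ℓ : Λ) (m₁ m₂ : F ℓ), dist m₁ m₂ < ε → ∀ x : E ℓ m₁,
            dist (A.chartInv m₁ m₂ (h ℓ m₁ m₂ x)) x ≤ C * dist m₁ m₂) ∧
          -- uniform Hölder continuity of the holonomy maps
          (∀ S : ∀ ℓ, F ℓ → ℝ≥0, (∀ (ℓ : Λ) (m : F ℓ), LipschitzWith (S ℓ m) (H ℓ m)) →
            (∃ b : ℝ≥0, ∀ (ℓ : Λ) (m : F ℓ), S ℓ m ≤ b) →
            ∃ θ : ℝ, 0 < θ ∧ θ ≤ 1 ∧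
              (∃ ρ : ℝ, ρ < 1 ∧ ∀ (ℓ : Λ) (m : F ℓ),
                (S ℓ m : ℝ) ^ θ * K ℓ m * lam ℓ m ≤ ρ) ∧
              (∀ R : ℝ, ∃ C : ℝ, ∀ (ℓ : Λ) (m₁ m₂ : F ℓ), dist m₁ m₂ < ε →
                ∀ x y : E ℓ m₁, dist x y ≤ R →
                  dist (h ℓ m₁ m₂ x) (h ℓ m₁ m₂ y) ≤ C * dist x y ^ θ) ∧
              ((∃ R : ℝ, ∀ (ℓ : Λ) (m : F ℓ) (x y : E ℓ m), dist x y ≤ R) →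
                ∃ C : ℝ, ∀ (ℓ : Λ) (m₁ m₂ : F ℓ), dist m₁ m₂ < ε → ∀ x y : E ℓ m₁,
                  dist (h ℓ m₁ m₂ x) (h ℓ m₁ m₂ y) ≤ C * dist x y ^ θ))) ∧
        -- the global partition and the global holonomy
        ((∃ ρ : ℝ≥0, ρ < 1 ∧ ∀ (ℓ : Λ) (m : F ℓ), lam ℓ m ≤ ρ) →
          (∀ p, p ∈ H.saturate W p) ∧
          Setoid.IsPartition (range (H.saturate W)) ∧
          H.Preserves (H.saturate W) ∧
          ((∀ ℓ, PreconnectedSpace (F ℓ)) →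
            ∃ g : ∀ (ℓ : Λ) (m₁ m₂ : F ℓ), E ℓ m₁ → E ℓ m₂,
              (∀ (ℓ : Λ) (m₁ m₂ : F ℓ) (x : E ℓ m₁) (y : E ℓ m₂),
                (⟨ℓ, m₂, y⟩ : LamTotal E) ∈ H.saturate W ⟨ℓ, m₁, x⟩ ↔ g ℓ m₁ m₂ x = y) ∧
              A.IsHolonomy H (fun _ _ _ => True) ε g)) := by
  obtain ⟨ε₀, hε₀, hε₀', hcharts⟩ := exists_radius_of_isUniformLipFiber hε' hA
  obtain ⟨L, hL⟩ := hbase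
  obtain ⟨ρ, hρ, hrate⟩ := hbunch
  obtain ⟨B, hKB⟩ := hKb
  refine ⟨ε₀, hε₀, hε₀', fun ε hε hεε₀ hplaque => ?_⟩
  have hB : IsBunchedBundleMap A H Hinv lam K L ρ ε :=
    { eps_pos := hε
      eps_le := hεε₀.le.trans hε₀'
      plaque := hplaque
      lipschitz_chart := fun ℓ m m' h => (hcharts ℓ m m' (h.trans hεε₀)).1
      lipschitz_chartInv := fun ℓ m m' h => (hcharts ℓ m m' (h.trans hεε₀)).2
      continuous := hH
      inv_apply := hleft
      -- The Lipschitz left inverse is continuous, so the clopen argument makes `H ℓ m` onto and the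
      -- left inverse two-sided.
      apply_inv := fun ℓ m => (hleft ℓ m).rightInverse_of_surjective
        (surjective_of_isOpen_range_of_leftInverse (hH ℓ m) (hK ℓ m).continuous (hleft ℓ m)
          (hopen ℓ m) (hcomp ℓ m))
      lipschitz_inv := hK
      lipschitz_base := hL
      rate_lt_one := hρ
      rate_le := hrate }
  refine ⟨holonomyGraph (A.localHolonomy H Hinv) ε,
    ⟨hB.isLocalPartition_holonomyGraph, hB.isLipGraphFamily_holonomyGraph,
      hB.preserves_holonomyGraph⟩,
    fun W' hW' hHW' => hB.eq_holonomyGraph hW' hHW',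
    ⟨A.localHolonomy H Hinv, fun ℓ m₁ m₂ h x y => by simp [mk_mem_holonomyGraph, h],
      hB.isHolonomy_localHolonomy,
      ⟨_, fun ℓ m₁ m₂ h x => hB.dist_chartInv_localHolonomy_le h x⟩, ?_⟩, ?_⟩
  · rintro S hS ⟨b, hb⟩
    obtain ⟨θ, hθ, hθ', hbθ, hR⟩ :=
      hB.exists_holder hKB fun ℓ m => (hS ℓ m).weaken (hb ℓ m)
    refine ⟨θ, hθ, hθ', ⟨_, hbθ, fun ℓ m => ?_⟩, hR, ?_⟩
    · rw [mul_assoc]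
      refine mul_le_mul ?_ (hB.rate_mul_le ℓ m) (by positivity) (by positivity)
      exact Real.rpow_le_rpow (NNReal.coe_nonneg _) (by exact_mod_cast hb ℓ m) hθ.le
    · rintro ⟨R, hbound⟩
      obtain ⟨C, hC⟩ := hR R
      exact ⟨C, fun ℓ m₁ m₂ h x y => hC ℓ m₁ m₂ h x y (hbound ℓ m₁ x y)⟩
  · rintro ⟨σ, hσ, hlamσ⟩
    exact ⟨hB.self_mem_saturate, hB.isPartition_saturate hσ hlamσ, hB.preserves_saturate,
      hB.exists_globalHolonomy hσ hlamσ⟩
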